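/- Monoids are commutative and cancellative. For a monoid $H$, let $H_{\mathrm{red}}=\{aH^\times : a\in H\}$, let $\mathcal A(\cdot)$ denote the set of atoms, let $\mathcal F(P)$ be the free abelian monoid with basis $P$ and $|\cdot|$ its length function. Let $\mathsf Z(H)=\mathcal F(\mathcal A(H_{\mathrm{red}}))$ be the factorization monoid and, for $a\in H$, let $\mathsf Z(a)\subset\mathsf Z(H)$ be the set of factorizations of $a$ and $\mathsf L(a)=\{|z| : z\in\mathsf Z(a)\}$ its set of lengths. For $z,y\in\mathsf Z(H)$ put $\mathsf d(z,y)=\max\{|z\gcd(z,y)^{-1}|,\,|y\gcd(z,y)^{-1}|\}$. For $G_0\subset\mathbb Z$ put $G_0^-=\{g\in G_0 : g<0\}$. For a sequence $S=g_1\cdots g_l\in\mathcal F(G_0)$ let $\sigma(S)=g_1+\dots+g_l$, let $\operatorname{supp}(S)=\{g_1,\dots,g_l\}$, let $\mathsf v_0(S)$ be the multiplicity of $0$ in $S$, and let $S^+$ be the subsequence of positive terms. Let $\mathcal B(G_0)=\{S\in\mathcal F(G_0) : \sigma(S)=0\}$, $\mathcal E(G_0)=\{(S_1,S_2)\in\mathcal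 F(G_0)^2 : \sigma(S_1)=\sigma(S_2)\}$ and $\mathcal S(G_0)=\{(S_1,S_2)\in\mathcal F(G_0)^2 : S_1=S_2\}$. For reduced monoids $S\subset D$, the relative Davenport constant $\mathsf D(S,D)$ is the least $N\in\mathbb N\cup\{\infty\}$, where $\mathbb N=\{1,2,\dots\}$, such that for every $1\ne z\in\mathcal F(\mathcal A(D))$ whose product lies in $S$ there is $1\neq z'\mid z$ whose product lies in $S$ and with $|z'|\le N$. Let $H$ be a Krull monoid and let $\varphi\colon H\to\mathcal F(P)$ be a cofinal divisor homomorphism into a free monoid (that is, $\varphi(a)\mid\varphi(b)$ implies $a\mid b$, and every element of $\mathcal F(P)$ divides some $\varphi(u)$ with $u\in H$). Suppose that the class group $G=\mathsf q(\mathcal F(P))/\mathsf q(\varphi(H))$ is infinite cyclic, and identify it with $\mathbb Z$ by an isomorphism. Let $G_P=\{[p] : p\in P\}\subset\mathbb Z$ be the set of classes containing prime divisors, and let $\boldsymbol\beta\colon H\to\mathcal B(G_P)$ be the block homomorphism, i.e. $\boldsymbol\beta=\widetilde{\boldsymbol\beta}\circ\varphi$ where $\widetilde{\boldsymbol\beta}\colon\mathcal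 F(P)\to\mathcal F(G_P)$ is the homomorphism with $p\mapsto[p]$. Suppose that $G_P^-$ is finite. Let $a\in H$ with $\max\mathsf L(a)=|\boldsymbol\beta(a)^+|+\mathsf v_0(\boldsymbol\beta(a))$, and let $M=|\min\operatorname{supp}(\boldsymbol\beta(a))|$ (with $M=0$ if $\operatorname{supp}(\boldsymbol\beta(a))=\emptyset$). Then for every $z\in\mathsf Z(a)$ and every $y\in\mathsf Z(a)$ with $|y|=\max\mathsf L(a)$ there is a chain $z=z_0,\dots,z_r=y$ of factorizations of $a$ such that $|z|=|z_0|\le\dots\le|z_r|=|y|$ and $$\mathsf d(z_i,z_{i+1})\le\max\{M\cdot\mathsf D(\mathcal S(G_P^-),\mathcal E(G_P^-)),\,2\}\quad\text{for all } i\in[0,r-1].$$ Moreover $\max\{M\cdot\mathsf D(\mathcal S(G_P^-),\mathcal E(G_P^-)),2\}\le\max\{|\min G_P|\cdot\mathsf D(\mathcal S(G_P^-),\mathcal E(G_P^-)),2\}<\infty$, and $\mathsf D(\mathcal S(G_P^-),\mathcal E(G_P^-))<\infty$. -/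

import Mathlib

universe u v

noncomputable section

namespace KrullFact

open Algebra

/-! ### Monoids and divisor theories -/

/-- The free abelian monoid `F(P)` with basis `P`, written multiplicatively. -/
abbrev FreeAb (P : Type u) : Type u := Multiplicative (Multiset P)

/-- The basis element of `F(P)` given by `p : P`. -/
def FreeAb.of {P : Type u} (p : P) : FreeAb P := Multiplicative.ofAdd {p}

/-- `φ a ∣ φ b` implies `a ∣ b`. -/
def IsDivisorHom {H : Type u} {D : Type v} [CommMonoid H] [CommMonoid D] (φ : H →* D) : Prop :=
  ∀ a b : H, φ a ∣ φ b → a ∣ b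

/-- Every element of `D` divides some `φ u`. -/
def IsCofinalHom {H : Type u} {D : Type v} [CommMonoid H] [CommMonoid D] (φ : H →* D) : Prop :=
  ∀ a : D, ∃ u : H, a ∣ φ u

/-- A divisor theory: a divisor homomorphism into a free abelian monoid such that every basis
element is the greatest common divisor of the image of a finite nonempty set. -/
def IsDivisorTheory {H : Type u} {P : Type v} [CommMonoid H] (φ : H →* FreeAb P) : Prop :=
  IsDivisorHom φ ∧
    ∀ p : P, ∃ X : Finset H, X.Nonempty ∧ (∀ x ∈ X, FreeAb.of p ∣ φ x) ∧
      ∀ d : FreeAb P, (∀ x ∈ X, d ∣ φ x) → d ∣ FreeAb.of p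

/-- A Krull monoid: a (commutative, cancellative) monoid which has a divisor theory. -/
def IsKrullMonoid (H : Type u) [CancelCommMonoid H] : Prop :=
  ∃ (P : Type u) (φ : H →* FreeAb P), IsDivisorTheory φ

/-! ### Class groups -/

/-- The class group `q(D) / q(φ(H))`, in additive notation. -/
abbrev ClassGrp {H : Type u} {D : Type v} [CommMonoid H] [CommMonoid D] (φ : H →* D) : Type v :=
  Additive (GrothendieckGroup D ⧸
    Subgroup.closure (Set.range fun h : H => GrothendieckGroup.of (φ h)))

/-- The class `[a]` of an element `a : D`. -/
def cls {H : Type u} {D : Type v} [CommMonoid H] [CommMonoid D] (φ : H →* D) (a : D) :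
    ClassGrp φ :=
  Additive.ofMul (QuotientGroup.mk (GrothendieckGroup.of a))

theorem cls_mul {H : Type u} {D : Type v} [CommMonoid H] [CommMonoid D] (φ : H →* D) (a b : D) :
    cls φ (a * b) = cls φ a + cls φ b := by
  unfold cls
  rw [map_mul]
  rfl

theorem cls_one {H : Type u} {D : Type v} [CommMonoid H] [CommMonoid D] (φ : H →* D) :
    cls φ 1 = 0 := by
  unfold cls
  rw [map_one]
  rfl

theorem cls_apply {H : Type u} {D : Type v} [CommMonoid H] [CommMonoid D] (φ : H →* D) (h : H) :
    cls φ (φ h) = 0 := by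
  have key : (QuotientGroup.mk (GrothendieckGroup.of (φ h)) : GrothendieckGroup D ⧸
      Subgroup.closure (Set.range fun h : H => GrothendieckGroup.of (φ h))) = 1 :=
    (QuotientGroup.eq_one_iff _).2 (Subgroup.subset_closure (Set.mem_range_self h))
  unfold cls
  rw [key]
  rfl

/-- The set `G_P` of classes containing prime divisors, as a set of integers via an
identification `e` of the class group with `ℤ`. -/
def primeClasses {H : Type u} {P : Type v} [CommMonoid H] (φ : H →* FreeAb P)
    (e : ClassGrp φ ≃+ ℤ) : Set ℤ :=
  Set.range fun p : P => e (cls φ (FreeAb.of p))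

/-! ### Sequences over sets of integers -/

/-- `G₀⁻ = G₀ ∩ (-ℕ)`, the negative elements of `G₀`. -/
def negPart (G₀ : Set ℤ) : Set ℤ := {g | g ∈ G₀ ∧ g < 0}

/-- The underlying multiset of integers of a sequence over `G₀`. -/
def terms {G₀ : Set ℤ} (S : FreeAb G₀) : Multiset ℤ :=
  (Multiplicative.toAdd S).map (fun g => (g : ℤ))

/-- The sum of a sequence. -/
def seqSum {G₀ : Set ℤ} (S : FreeAb G₀) : ℤ := (terms S).sum

theorem seqSum_one {G₀ : Set ℤ} : seqSum (1 : FreeAb G₀) = 0 := by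
  simp [seqSum, terms]

theorem seqSum_mul {G₀ : Set ℤ} (S T : FreeAb G₀) : seqSum (S * T) = seqSum S + seqSum T := by
  simp [seqSum, terms]

/-- The support of a sequence. -/
def supp {G₀ : Set ℤ} (S : FreeAb G₀) : Set ℤ := {g | g ∈ terms S}

/-- The length `|S⁺|` of the subsequence of positive terms. -/
def posLength {G₀ : Set ℤ} (S : FreeAb G₀) : ℕ := ((terms S).filter (fun g => 0 < g)).card

/-- The multiplicity `v₀(S)` of zero in `S`. -/
def zeroMult {G₀ : Set ℤ} (S : FreeAb G₀) : ℕ := (terms S).count 0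

/-- `|min X|`; it is only used for sets of integers that have a minimum, and for the empty set,
where its value is `0`. -/
def absMin (X : Set ℤ) : ℕ := (sInf X).natAbs

/-- The monoid `B(G₀)` of zero-sum sequences over `G₀`. -/
def zeroSumMonoid (G₀ : Set ℤ) : Submonoid (FreeAb G₀) where
  carrier := {S | seqSum S = 0}
  one_mem' := seqSum_one
  mul_mem' {S T} hS hT := by
    have hS' : seqSum S = 0 := hS
    have hT' : seqSum T = 0 := hT
    show seqSum (S * T) = 0
    rw [seqSum_mul, hS', hT', add_zero]

/-- The homomorphism `F(P) → F(G_P)` with `p ↦ [p]`. -/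
def preBlockHom {H : Type u} {P : Type v} [CommMonoid H] (φ : H →* FreeAb P)
    (e : ClassGrp φ ≃+ ℤ) : FreeAb P →* FreeAb (primeClasses φ e) :=
  AddMonoidHom.toMultiplicative (Multiset.mapAddMonoidHom
    fun p : P => (⟨e (cls φ (FreeAb.of p)), p, rfl⟩ : primeClasses φ e))

theorem seqSum_preBlockHom {H : Type u} {P : Type v} [CommMonoid H] (φ : H →* FreeAb P)
    (e : ClassGrp φ ≃+ ℤ) (a : FreeAb P) : seqSum (preBlockHom φ e a) = e (cls φ a) := by
  refine Multiset.induction_on (p := fun s : Multiset P =>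
    seqSum (preBlockHom φ e (Multiplicative.ofAdd s)) = e (cls φ (Multiplicative.ofAdd s)))
    (Multiplicative.toAdd a) ?_ ?_
  · rw [ofAdd_zero, map_one, seqSum_one, cls_one, map_zero]
  · intro p s ih
    rw [← Multiset.singleton_add, ofAdd_add, map_mul, seqSum_mul, ih, cls_mul, map_add]
    congr 1
    simp [preBlockHom, seqSum, terms, FreeAb.of]

/-- The block homomorphism `β : H → B(G_P)`. -/
def blockHom {H : Type u} {P : Type v} [CommMonoid H] (φ : H →* FreeAb P)
    (e : ClassGrp φ ≃+ ℤ) : H →* zeroSumMonoid (primeClasses φ e) :=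
  ((preBlockHom φ e).comp φ).codRestrict (zeroSumMonoid (primeClasses φ e)) fun h => by
    show seqSum (preBlockHom φ e (φ h)) = 0
    rw [seqSum_preBlockHom, cls_apply, map_zero]

/-! ### Factorizations -/

/-- The factorization monoid `Z(H) = F(A(H_red))`, written additively: a factorization is a
multiset of atoms of the associated reduced monoid. -/
abbrev Factorization (H : Type u) [CommMonoid H] : Type u :=
  Multiset {x : Associates H // Irreducible x}

/-- The set `Z(a)` of factorizations of `a`. -/
def factorizations {H : Type u} [CommMonoid H] (a : H) : Set (Factorization H) :=
  {z | (z.map Subtype.val).prod = Associates.mk a}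

/-- The set of lengths `L(a)`. -/
def lengths {H : Type u} [CommMonoid H] (a : H) : Set ℕ :=
  {n | ∃ z ∈ factorizations a, z.card = n}

open Classical in
/-- The distance of two factorizations: the larger of the lengths of the two factorizations
after cancelling their greatest common divisor `z ∩ y`. -/
def factDist {H : Type u} [CommMonoid H] (z y : Factorization H) : ℕ :=
  max (z - z ∩ y).card (y - z ∩ y).card

/-! ### The relative Davenport constant -/

/-- The relative Davenport constant `D(S, D)` of a submonoid `S` of a reduced monoid `D`: the
least positive integer `N` (or `∞`) such that every nonempty product of atoms of `D` that lies
in `S` has a nonempty subproduct of at most `N` factors that lies in `S`. -/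
def relDavenport {D : Type u} [CommMonoid D] (S : Submonoid D) : ℕ∞ :=
  sInf {N : ℕ∞ | 1 ≤ N ∧ ∀ z : Multiset {x : D // Irreducible x}, z ≠ 0 →
    (z.map Subtype.val).prod ∈ S →
      ∃ z' ≤ z, z' ≠ 0 ∧ (z'.map Subtype.val).prod ∈ S ∧ (z'.card : ℕ∞) ≤ N}

/-- `E(G₀)`: pairs of sequences over `G₀` with equal sums. -/
def equalSumPairs (G₀ : Set ℤ) : Submonoid (FreeAb G₀ × FreeAb G₀) where
  carrier := {T | seqSum T.1 = seqSum T.2}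
  one_mem' := rfl
  mul_mem' {S T} hS hT := by
    have hS' : seqSum S.1 = seqSum S.2 := hS
    have hT' : seqSum T.1 = seqSum T.2 := hT
    show seqSum (S.1 * T.1) = seqSum (S.2 * T.2)
    rw [seqSum_mul, seqSum_mul, hS', hT']

/-- `S(G₀)`: the symmetric pairs, as a submonoid of `E(G₀)`. -/
def symmetricPairs (G₀ : Set ℤ) : Submonoid (equalSumPairs G₀) where
  carrier := {T | T.1.1 = T.1.2}
  one_mem' := rfl
  mul_mem' {S T} hS hT := by
    have hS' : S.1.1 = S.1.2 := hS
    have hT' : T.1.1 = T.1.2 := hT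
    show S.1.1 * T.1.1 = S.1.2 * T.1.2
    rw [hS', hT']

/-- The bound `max {M * D(S(G₀⁻), E(G₀⁻)), 2}`. -/
def stepBound (M : ℕ) (G₀ : Set ℤ) : ℕ∞ :=
  max (M * relDavenport (symmetricPairs (negPart G₀))) 2

end KrullFact

end

open KrullFact

namespace KrullFact

/-! Since `φ` is a divisor homomorphism, factorizations of `a` correspond to factorizations of the
multiset `φ a` into minimal multisets over `P` of weight zero, the weight of a prime being its
class. Each such atom has a term of nonnegative weight, so when the maximal length equals the number
of nonnegative terms, every atom of `y` has exactly one. Hence each atom of `z` can be matched with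
a part of `y` having the same nonnegative terms (`exists_isMatching`).

In a matched pair the negative weights on the two sides have equal sums, so surplus and deficit form
an element of E(G_P⁻). The product over all pairs is symmetric, because `z` and `y` have the same
total. The relative Davenport constant D thus provides a nontrivial exchange of negative terms among
at most D atoms of `z` (`IsMatching.exists_exchange`). An atom has at most M nonnegative terms, so
the changed atoms refactor into at most M·D atoms, and never into fewer than before. Either the
length grows or the surplus shrinks (`IsMatching.exists_step`), so the surplus eventually vanishes.
Matched atoms then have equal weights, and swaps of terms of equal weight lead to `y`; each swap
changes two atoms, whence the 2 in the bound (`reflTransGen_of_map_eq`).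

D is finite by Dickson's lemma, used once for the atoms of E(G_P⁻) and once for the minimal products
of atoms that lie in S(G_P⁻). -/

/-! ### Splitting and counting for multisets. -/

open Classical in
theorem exists_le_map_eq {α β : Type*} (f : α → β) :
    ∀ (t : Multiset β) (s : Multiset α), t ≤ s.map f → ∃ r ≤ s, r.map f = t := by
  intro t
  induction t using Multiset.induction_on with
  | empty => exact fun s _ => ⟨0, Multiset.zero_le _, rfl⟩
  | cons b t ih =>
    intro s h
    have hb : b ∈ s.map f := Multiset.mem_of_le h (Multiset.mem_cons_self b t)
    obtain ⟨x, hx, rfl⟩ := Multiset.mem_map.1 hb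
    obtain ⟨s, rfl⟩ := Multiset.exists_cons_of_mem hx
    rw [Multiset.map_cons, Multiset.cons_le_cons_iff] at h
    obtain ⟨r, hr, rfl⟩ := ih s h
    exact ⟨x ::ₘ r, (Multiset.cons_le_cons_iff x).2 hr, Multiset.map_cons _ _ _⟩

/-- A multiset whose image under `f` is a sum indexed by `C` splits accordingly. -/
theorem exists_split_map_eq {ι α β : Type*} (f : α → β) (g : ι → Multiset β) (C : Multiset ι) :
    ∀ s : Multiset α, s.map f = (C.map g).sum →
      ∃ E : Multiset (ι × Multiset α), E.map Prod.fst = C ∧ (E.map Prod.snd).sum = s ∧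
        ∀ e ∈ E, e.2.map f = g e.1 := by
  induction C using Multiset.induction_on with
  | empty =>
    intro s h
    refine ⟨0, rfl, ?_, by simp⟩
    simpa [eq_comm] using h
  | cons c C ih =>
    intro s h
    rw [Multiset.map_cons, Multiset.sum_cons] at h
    obtain ⟨r, hr, hrg⟩ := exists_le_map_eq f (g c) s (h ▸ Multiset.le_add_right _ _)
    obtain ⟨t, rfl⟩ := Multiset.le_iff_exists_add.1 hr
    rw [Multiset.map_add, hrg, add_right_inj] at h
    obtain ⟨E, h1, h2, h3⟩ := ih t h
    refine ⟨(c, r) ::ₘ E, by simp [h1], by simp [h2], ?_⟩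
    intro x hx
    rcases Multiset.mem_cons.1 hx with rfl | hx
    · exact hrg
    · exact h3 x hx

open Classical in
/-- A submultiset of a sum indexed by `C` splits accordingly. -/
theorem exists_split_le {ι α : Type*} (f : ι → Multiset α) (C : Multiset ι) :
    ∀ s : Multiset α, s ≤ (C.map f).sum →
      ∃ E : Multiset (ι × Multiset α), E.map Prod.fst = C ∧ (E.map Prod.snd).sum = s ∧
        ∀ e ∈ E, e.2 ≤ f e.1 := by
  induction C using Multiset.induction_on with
  | empty =>
    intro s h
    refine ⟨0, rfl, ?_, by simp⟩
    simpa [eq_comm] using h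
  | cons c C ih =>
    intro s h
    rw [Multiset.map_cons, Multiset.sum_cons] at h
    -- Greedy split: `c` takes `s ∩ f c`, and the remainder `s - f c` goes to the other indices.
    obtain ⟨E, h1, h2, h3⟩ := ih (s - f c) (by rwa [tsub_le_iff_left])
    refine ⟨(c, s ∩ f c) ::ₘ E, by simp [h1], ?_, ?_⟩
    · rw [Multiset.map_cons, Multiset.sum_cons, h2, add_comm]
      exact Multiset.sub_add_inter s (f c)
    · intro x hx
      rcases Multiset.mem_cons.1 hx with rfl | hx
      · exact Multiset.inter_le_right
      · exact h3 x hx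

theorem exists_map_fst_eq {κ τ : Type*} (p : κ → τ → Prop) (K : Multiset κ)
    (h : ∀ k ∈ K, ∃ t, p k t) :
    ∃ E : Multiset (κ × τ), E.map Prod.fst = K ∧ ∀ e ∈ E, p e.1 e.2 := by
  induction K using Multiset.induction_on with
  | empty => exact ⟨0, rfl, by simp⟩
  | cons k K ih =>
    obtain ⟨E, h1, h2⟩ := ih fun k hk => h k (Multiset.mem_cons_of_mem hk)
    obtain ⟨t, ht⟩ := h k (Multiset.mem_cons_self k K)
    refine ⟨(k, t) ::ₘ E, by simp [h1], ?_⟩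
    intro x hx
    rcases Multiset.mem_cons.1 hx with rfl | hx
    · exact ht
    · exact h2 x hx

theorem eq_map_singleton_sum {α : Type*} (Q : Multiset (Multiset α)) (h : ∀ q ∈ Q, q.card = 1) :
    Q = Q.sum.map fun x => {x} := by
  induction Q using Multiset.induction_on with
  | empty => rfl
  | cons q Q ih =>
    obtain ⟨x, rfl⟩ := Multiset.card_eq_one.1 (h q (Multiset.mem_cons_self q Q))
    rw [Multiset.sum_cons, Multiset.map_add, Multiset.map_singleton, Multiset.singleton_add,
      ← ih fun q hq => h q (Multiset.mem_cons_of_mem hq)]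

theorem card_le_sum_map {α : Type*} (f : α → ℕ) (Q : Multiset α) (h : ∀ q ∈ Q, 1 ≤ f q) :
    Q.card ≤ (Q.map f).sum := by
  have := Multiset.card_nsmul_le_sum (s := Q.map f) (a := 1) (by simpa using h)
  simpa using this

theorem eq_one_of_sum_map_le_card {α : Type*} (f : α → ℕ) (Q : Multiset α)
    (h : ∀ q ∈ Q, 1 ≤ f q) (hs : (Q.map f).sum ≤ Q.card) : ∀ q ∈ Q, f q = 1 := by
  intro q hq
  obtain ⟨Q, rfl⟩ := Multiset.exists_cons_of_mem hq
  have h1 := card_le_sum_map f Q fun q hq => h q (Multiset.mem_cons_of_mem hq)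
  have h2 := h q hq
  simp only [Multiset.map_cons, Multiset.sum_cons, Multiset.card_cons] at hs
  omega

theorem sum_map_card_eq {α β : Type*} (f : α → Multiset β) (Q : Multiset α) :
    (Q.map fun q => (f q).card).sum = (Q.map f).sum.card := by
  induction Q using Multiset.induction_on with
  | empty => rfl
  | cons q Q ih => simp [ih]

theorem filter_sum_map {α β : Type*} (p : β → Prop) [DecidablePred p] (f : α → Multiset β)
    (Q : Multiset α) : (Q.map f).sum.filter p = (Q.map fun q => (f q).filter p).sum := by
  induction Q using Multiset.induction_on with
  | empty => rfl
  | cons q Q ih => simp [ih]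

theorem map_sum_map {α β γ : Type*} (g : β → γ) (f : α → Multiset β)
    (Q : Multiset α) : (Q.map f).sum.map g = (Q.map fun q => (f q).map g).sum := by
  induction Q using Multiset.induction_on with
  | empty => rfl
  | cons q Q ih => simp [ih]

/-- Exchanging part of the surplus of `T` over `N` against part of the deficit. -/
theorem exchange_sub {α : Type*} [DecidableEq α] {T N A B : Multiset α} (hA : A ≤ T - N) (hB : B ≤ N - T) :
    T - A + B - N = T - N - A := by
  ext x
  have h1 := Multiset.le_iff_count.1 hA x
  have h2 := Multiset.le_iff_count.1 hB x
  simp only [Multiset.count_sub, Multiset.count_add] at *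
  omega

/-! ### Dickson's lemma and finiteness of relative Davenport constants. -/

-- Dickson's lemma: multiplicities embed these multisets into a finite power of `ℕ`.
open Classical in
instance wellQuasiOrderedLE_multiset {α : Type*} [Finite α] :
    WellQuasiOrderedLE (Multiset α) where
  wqo := by
    intro f
    obtain ⟨m, n, hmn, h⟩ := wellQuasiOrdered_le (fun n a => (f n).count a : ℕ → α → ℕ)
    exact ⟨m, n, hmn, Multiset.le_iff_count.2 h⟩

/-- The product of a multiset of atoms. -/
def atomProd {D : Type u} [CommMonoid D] (z : Multiset {x : D // Irreducible x}) : D :=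
  (z.map Subtype.val).prod

theorem atomProd_zero {D : Type u} [CommMonoid D] :
    atomProd (0 : Multiset {x : D // Irreducible x}) = 1 := by
  simp [atomProd]

theorem atomProd_add {D : Type u} [CommMonoid D] (z y : Multiset {x : D // Irreducible x}) :
    atomProd (z + y) = atomProd z * atomProd y := by
  simp [atomProd]

theorem atomProd_ne_one {D : Type u} [CommMonoid D] {z : Multiset {x : D // Irreducible x}}
    (hz : z ≠ 0) : atomProd z ≠ 1 := by
  obtain ⟨x, hx⟩ := Multiset.exists_mem_of_ne_zero hz
  intro h
  have : x.1 ∣ atomProd z := Multiset.dvd_prod (Multiset.mem_map_of_mem _ hx)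
  rw [h] at this
  exact x.2.not_isUnit (isUnit_of_dvd_one this)

/-- The infimum is attained because `ℕ∞` is well-ordered; the set is nonempty since it contains `⊤`.
-/
theorem relDavenport_mem {D : Type u} [CommMonoid D] (S : Submonoid D) :
    1 ≤ relDavenport S ∧ ∀ z : Multiset {x : D // Irreducible x}, z ≠ 0 → atomProd z ∈ S →
      ∃ z' ≤ z, z' ≠ 0 ∧ atomProd z' ∈ S ∧ (z'.card : ℕ∞) ≤ relDavenport S :=
  csInf_mem (s := {N : ℕ∞ | 1 ≤ N ∧ ∀ z : Multiset {x : D // Irreducible x}, z ≠ 0 →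
    (z.map Subtype.val).prod ∈ S →
      ∃ z' ≤ z, z' ≠ 0 ∧ (z'.map Subtype.val).prod ∈ S ∧ (z'.card : ℕ∞) ≤ N})
    ⟨⊤, le_top, fun z hz hzS => ⟨z, le_rfl, hz, hzS, le_top⟩⟩

/-- A relative Davenport constant is finite if the ambient monoid has only finitely many atoms. -/
theorem relDavenport_lt_top {D : Type u} [CommMonoid D] [Finite {x : D // Irreducible x}]
    (S : Submonoid D) : relDavenport S < ⊤ := by
  let T : Set (Multiset {x : D // Irreducible x}) := {z | z ≠ 0 ∧ atomProd z ∈ S}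
  -- Every product in `S` contains a minimal one; these form an antichain, so their lengths are
  -- bounded.
  have hfin : {z | Minimal (· ∈ T) z}.Finite :=
    WellQuasiOrderedLE.finite_of_isAntichain (setOfPred_minimal_antichain _)
  obtain ⟨N, hN⟩ := (hfin.image Multiset.card).bddAbove
  -- `N + 1` instead of `N`, because the constant has to be at least 1 even when `N = 0`.
  refine lt_of_le_of_lt (sInf_le (a := ((N + 1 : ℕ) : ℕ∞)) ⟨?_, ?_⟩) (ENat.natCast_lt_top _)
  · exact_mod_cast Nat.le_add_left 1 N
  · intro z hz hzS
    obtain ⟨y, hyz, hy⟩ := exists_minimal_le_of_wellFoundedLT (· ∈ T) z ⟨hz, hzS⟩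
    refine ⟨y, hyz, hy.prop.1, hy.prop.2, ?_⟩
    have : y.card ≤ N := hN (Set.mem_image_of_mem _ hy)
    exact_mod_cast this.trans (Nat.le_succ N)

/-! ### Factorizations of pairs of sequences with equal sums -/

theorem terms_eq_map {G₀ : Set ℤ} (S : FreeAb G₀) :
    terms S = (Multiplicative.toAdd S).map Subtype.val := by
  simp [terms, Multiset.bind_def, Multiset.pure_def, Multiset.bind_singleton]

section EqualSumPairs

variable {G₀ : Set ℤ}

/-- The first sequence of a pair. -/
def lft (x : equalSumPairs G₀) : Multiset G₀ := Multiplicative.toAdd x.1.1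

/-- The second sequence of a pair. -/
def rgt (x : equalSumPairs G₀) : Multiset G₀ := Multiplicative.toAdd x.1.2

theorem lft_mul (x y : equalSumPairs G₀) : lft (x * y) = lft x + lft y := rfl

theorem rgt_mul (x y : equalSumPairs G₀) : rgt (x * y) = rgt x + rgt y := rfl

theorem equalSumPairs_ext {x y : equalSumPairs G₀} (h1 : lft x = lft y) (h2 : rgt x = rgt y) :
    x = y :=
  Subtype.ext (Prod.ext h1 h2)

theorem sum_lft_eq_sum_rgt (x : equalSumPairs G₀) :
    ((lft x).map Subtype.val).sum = ((rgt x).map Subtype.val).sum := by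
  have h : seqSum x.1.1 = seqSum x.1.2 := x.2
  rwa [seqSum, seqSum, terms_eq_map, terms_eq_map] at h

/-- The pair of two sequences with equal sums. -/
def mkPair (A B : Multiset G₀)
    (h : (A.map Subtype.val).sum = (B.map Subtype.val).sum) : equalSumPairs G₀ :=
  ⟨(Multiplicative.ofAdd A, Multiplicative.ofAdd B), by
    change seqSum _ = seqSum _
    rw [seqSum, seqSum, terms_eq_map, terms_eq_map]
    exact h⟩

theorem eq_one_of_isUnit {x : equalSumPairs G₀} (hx : IsUnit x) : x = 1 := by
  obtain ⟨y, hy⟩ := hx.exists_right_inv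
  have h1 : lft x + lft y = 0 := congrArg lft hy
  have h2 : rgt x + rgt y = 0 := congrArg rgt hy
  exact equalSumPairs_ext (add_eq_zero.1 h1).1 (add_eq_zero.1 h2).1

/-- A nonunit has positive total length, so a proper splitting shortens both factors. -/
theorem exists_atomProd_eq (x : equalSumPairs G₀) :
    ∃ z : Multiset {x : equalSumPairs G₀ // Irreducible x}, atomProd z = x := by
  induction hn : (lft x).card + (rgt x).card using Nat.strong_induction_on generalizing x with
  | _ n ih =>
    by_cases h1 : x = 1
    · exact ⟨0, by rw [h1, atomProd_zero]⟩
    by_cases hx : Irreducible x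
    · exact ⟨{⟨x, hx⟩}, by simp [atomProd]⟩
    rw [irreducible_iff] at hx
    push Not at hx
    obtain ⟨a, b, hab, ha, hb⟩ := hx fun h => h1 (eq_one_of_isUnit h)
    have hpos : ∀ y : equalSumPairs G₀, ¬ IsUnit y → 0 < (lft y).card + (rgt y).card := by
      intro y hy
      by_contra h0
      have h0 : (lft y).card = 0 ∧ (rgt y).card = 0 := by omega
      refine hy ?_
      have : y = 1 :=
        equalSumPairs_ext (Multiset.card_eq_zero.1 h0.1) (Multiset.card_eq_zero.1 h0.2)
      rw [this]
      exact isUnit_one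
    have hpa := hpos a ha
    have hpb := hpos b hb
    rw [hab, lft_mul, rgt_mul, Multiset.card_add, Multiset.card_add] at hn
    obtain ⟨z, hz⟩ := ih _ (by omega) a rfl
    obtain ⟨y, hy⟩ := ih _ (by omega) b rfl
    exact ⟨z + y, by rw [atomProd_add, hz, hy, hab]⟩

/-- If one atom is componentwise contained in another, the quotient again has equal sums and so lies
in the monoid, which makes it trivial. The atoms therefore form an antichain. -/
instance finite_atoms [Finite G₀] : Finite {x : equalSumPairs G₀ // Irreducible x} := by
  let f : {x : equalSumPairs G₀ // Irreducible x} → Multiset G₀ × Multiset G₀ :=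
    fun x => (lft x.1, rgt x.1)
  have hf : ∀ x y, f x ≤ f y → x = y := by
    rintro ⟨x, hx⟩ ⟨y, hy⟩ ⟨h1, h2⟩
    obtain ⟨A, hA⟩ := Multiset.le_iff_exists_add.1 h1
    obtain ⟨B, hB⟩ := Multiset.le_iff_exists_add.1 h2
    replace hA : lft y = lft x + A := hA
    replace hB : rgt y = rgt x + B := hB
    have hAB : (A.map Subtype.val).sum = (B.map Subtype.val).sum := by
      have h3 := sum_lft_eq_sum_rgt y
      have h4 := sum_lft_eq_sum_rgt x
      rw [hA, hB] at h3
      simp only [Multiset.map_add, Multiset.sum_add] at h3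
      linarith
    have hxy : y = x * mkPair A B hAB := equalSumPairs_ext hA hB
    rcases hy.isUnit_or_isUnit hxy with h | h
    · exact absurd h hx.not_isUnit
    · rw [eq_one_of_isUnit h, mul_one] at hxy
      exact Subtype.ext hxy.symm
  have hinj : Function.Injective f := fun x y h => hf x y h.le
  have : (Set.range f).Finite := by
    refine WellQuasiOrderedLE.finite_of_isAntichain ?_
    rintro _ ⟨x, rfl⟩ _ ⟨y, rfl⟩ hne hle
    exact hne (congrArg f (hf x y hle))
  exact (Set.finite_range_iff hinj).1 this

/-- The first sequence of the product of a multiset of atoms, over `ℤ`. -/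
def lftHom : Multiset {x : equalSumPairs G₀ // Irreducible x} →+ Multiset ℤ where
  toFun z := (lft (atomProd z)).map Subtype.val
  map_zero' := by rw [atomProd_zero]; rfl
  map_add' z y := by rw [atomProd_add, lft_mul, Multiset.map_add]

/-- The second sequence of the product of a multiset of atoms, over `ℤ`. -/
def rgtHom : Multiset {x : equalSumPairs G₀ // Irreducible x} →+ Multiset ℤ where
  toFun z := (rgt (atomProd z)).map Subtype.val
  map_zero' := by rw [atomProd_zero]; rfl
  map_add' z y := by rw [atomProd_add, rgt_mul, Multiset.map_add]

theorem sum_lftHom_eq (z : Multiset {x : equalSumPairs G₀ // Irreducible x}) :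
    (lftHom z).sum = (rgtHom z).sum :=
  sum_lft_eq_sum_rgt _

theorem atomProd_mem_symmetricPairs_iff
    (z : Multiset {x : equalSumPairs G₀ // Irreducible x}) :
    atomProd z ∈ symmetricPairs G₀ ↔ lftHom z = rgtHom z :=
  (Multiset.map_injective Subtype.val_injective).eq_iff.symm

/-- An empty first sequence forces the second to have sum zero, hence to be empty when all terms are
negative. This makes every exchange remove at least one term. -/
theorem lftHom_ne_zero (hG : ∀ g ∈ G₀, g < 0)
    {z : Multiset {x : equalSumPairs G₀ // Irreducible x}} (hz : z ≠ 0) : lftHom z ≠ 0 := by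
  intro h
  have h1 : lft (atomProd z) = 0 := Multiset.map_eq_zero.1 h
  have h2 : ((rgt (atomProd z)).map Subtype.val).sum = 0 := by
    rw [← sum_lft_eq_sum_rgt, h1]
    rfl
  have h3 : rgt (atomProd z) = 0 := by
    by_contra hne
    have := Multiset.sum_lt_sum_of_nonempty (s := rgt (atomProd z)) (f := Subtype.val)
      (g := fun _ => 0) hne fun g _ => hG g.1 g.2
    simp [h2] at this
  exact atomProd_ne_one hz (equalSumPairs_ext h1 h3)

theorem exists_lift_eq {A : Multiset ℤ} (hA : ∀ g ∈ A, g ∈ G₀) :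
    ∃ B : Multiset G₀, B.map Subtype.val = A :=
  CanLift.prf (self := Multiset.canLift (c := Subtype.val) (p := fun g => g ∈ G₀)) A hA

theorem exists_lftHom_rgtHom_eq {A B : Multiset ℤ} (hA : ∀ g ∈ A, g ∈ G₀) (hB : ∀ g ∈ B, g ∈ G₀)
    (h : A.sum = B.sum) :
    ∃ z : Multiset {x : equalSumPairs G₀ // Irreducible x}, lftHom z = A ∧ rgtHom z = B := by
  obtain ⟨A, rfl⟩ := exists_lift_eq hA
  obtain ⟨B, rfl⟩ := exists_lift_eq hB
  obtain ⟨z, hz⟩ := exists_atomProd_eq (mkPair A B h)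
  refine ⟨z, ?_, ?_⟩
  · change (lft (atomProd z)).map _ = _
    rw [hz]
    rfl
  · change (rgt (atomProd z)).map _ = _
    rw [hz]
    rfl

open Classical in
/-- Given a family of pairs of sequences with equal sums whose total is symmetric, subsequences
of at most `D(S(G₀), E(G₀))` of the pairs form a symmetric total. -/
theorem exists_symmetric_subpairs (hG : ∀ g ∈ G₀, g < 0) {N : ℕ}
    (hN : relDavenport (symmetricPairs G₀) = N) {ι : Type*} (C : Multiset ι)
    (X Y : ι → Multiset ℤ) (hX : ∀ c ∈ C, ∀ g ∈ X c, g ∈ G₀) (hY : ∀ c ∈ C, ∀ g ∈ Y c, g ∈ G₀)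
    (hs : ∀ c ∈ C, (X c).sum = (Y c).sum) (hXY : (C.map X).sum = (C.map Y).sum)
    (hne : ∃ c ∈ C, X c ≠ 0) :
    ∃ K : Multiset (ι × Multiset ℤ × Multiset ℤ), K ≠ 0 ∧ K.card ≤ N ∧ K.map Prod.fst ≤ C ∧
      (K.map fun k => k.2.1).sum = (K.map fun k => k.2.2).sum ∧
      ∀ k ∈ K, k.2.1 ≤ X k.1 ∧ k.2.2 ≤ Y k.1 ∧ k.2.1 ≠ 0 ∧ k.2.1.sum = k.2.2.sum := by
  have hF : ∀ c ∈ C, ∃ z : Multiset {x : equalSumPairs G₀ // Irreducible x},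
      lftHom z = X c ∧ rgtHom z = Y c :=
    fun c hc => exists_lftHom_rgtHom_eq (hX c hc) (hY c hc) (hs c hc)
  choose! F hF using hF
  have hL : lftHom (C.map F).sum = (C.map X).sum := by
    rw [map_multiset_sum, Multiset.map_map]
    exact congrArg _ (Multiset.map_congr rfl fun c hc => (hF c hc).1)
  have hR : rgtHom (C.map F).sum = (C.map Y).sum := by
    rw [map_multiset_sum, Multiset.map_map]
    exact congrArg _ (Multiset.map_congr rfl fun c hc => (hF c hc).2)
  have hne' : (C.map F).sum ≠ 0 := by
    obtain ⟨c, hc, hXc⟩ := hne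
    intro h0
    refine hXc ?_
    have h1 : F c ≤ (C.map F).sum := Multiset.le_sum_of_mem (Multiset.mem_map_of_mem F hc)
    rw [h0, Multiset.le_zero] at h1
    rw [← (hF c hc).1, h1, map_zero]
  obtain ⟨z, hz, hz0, hzS, hzN⟩ := (relDavenport_mem (symmetricPairs G₀)).2 _ hne'
    ((atomProd_mem_symmetricPairs_iff _).2 (by rw [hL, hR, hXY]))
  rw [hN] at hzN
  -- The symmetric subproduct `z` is distributed over the pairs its atoms come from. Once empty
  -- shares are dropped, at most `z.card` pairs remain.
  obtain ⟨E, hE1, hE2, hE3⟩ := exists_split_le F C z hz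
  let E' := E.filter fun e => e.2 ≠ 0
  have hE'z : (E'.map Prod.snd).sum = z := by
    rw [← hE2, ← Multiset.filter_add_not (fun e => e.2 ≠ 0) E, Multiset.map_add,
      Multiset.sum_add]
    symm
    refine add_eq_left.2 (Multiset.sum_eq_zero ?_)
    intro w hw
    obtain ⟨e, he, rfl⟩ := Multiset.mem_map.1 hw
    exact not_not.1 (Multiset.mem_filter.1 he).2
  have hE'0 : ∀ e ∈ E', e.2 ≠ 0 := fun e he => (Multiset.mem_filter.1 he).2
  have hE'C : E'.map Prod.fst ≤ C := hE1 ▸ Multiset.map_le_map (Multiset.filter_le _ E)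
  refine ⟨E'.map fun e => (e.1, lftHom e.2, rgtHom e.2), ?_, ?_, ?_, ?_, ?_⟩
  · intro h
    rw [Multiset.map_eq_zero] at h
    rw [h] at hE'z
    exact hz0 (by simpa [eq_comm] using hE'z)
  · rw [Multiset.card_map]
    refine (card_le_sum_map (fun e => e.2.card) E' fun e he =>
      Multiset.card_pos.2 (hE'0 e he)).trans ?_
    rw [sum_map_card_eq]
    exact_mod_cast (congrArg Multiset.card hE'z).trans_le (by exact_mod_cast hzN)
  · rw [Multiset.map_map]
    exact hE'C
  · rw [Multiset.map_map, Multiset.map_map]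
    have h1 := (atomProd_mem_symmetricPairs_iff _).1 hzS
    rw [← hE'z, map_multiset_sum, map_multiset_sum, Multiset.map_map, Multiset.map_map] at h1
    exact h1
  · intro k hk
    obtain ⟨e, he, rfl⟩ := Multiset.mem_map.1 hk
    have heC : e.1 ∈ C := Multiset.mem_of_le hE'C (Multiset.mem_map_of_mem _ he)
    obtain ⟨t, ht⟩ := Multiset.le_iff_exists_add.1 (hE3 e (Multiset.mem_filter.1 he).1)
    refine ⟨?_, ?_, lftHom_ne_zero hG (hE'0 e he), sum_lftHom_eq _⟩
    · rw [← (hF e.1 heC).1, ht, map_add]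
      exact Multiset.le_add_right _ _
    · rw [← (hF e.1 heC).2, ht, map_add]
      exact Multiset.le_add_right _ _

end EqualSumPairs

/-! ### Zero-sum multisets over a weighted set -/

section Weighted

variable {P : Type v} (w : P → ℤ)

/-- The subsequence of terms of nonnegative weight. -/
def nonnegTerms (U : Multiset P) : Multiset P := U.filter fun p => 0 ≤ w p

/-- The subsequence of terms of negative weight. -/
def negTerms (U : Multiset P) : Multiset P := U.filter fun p => ¬ 0 ≤ w p

/-- A minimal nonempty multiset of weight zero. -/
def IsZeroSumAtom (U : Multiset P) : Prop :=
  U ≠ 0 ∧ (U.map w).sum = 0 ∧ ∀ V ≤ U, (V.map w).sum = 0 → V = 0 ∨ V = U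

/-- `z` is a factorization of `S` into zero-sum atoms. -/
def IsFactorization (S : Multiset P) (z : Multiset (Multiset P)) : Prop :=
  (∀ U ∈ z, IsZeroSumAtom w U) ∧ z.sum = S

theorem nonnegTerms_add (U V : Multiset P) :
    nonnegTerms w (U + V) = nonnegTerms w U + nonnegTerms w V := Multiset.filter_add _ _ _

theorem negTerms_add (U V : Multiset P) :
    negTerms w (U + V) = negTerms w U + negTerms w V := Multiset.filter_add _ _ _

theorem nonnegTerms_add_negTerms (U : Multiset P) : nonnegTerms w U + negTerms w U = U :=
  Multiset.filter_add_not _ _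

theorem negTerms_le (U : Multiset P) : negTerms w U ≤ U := Multiset.filter_le _ _

variable {w}

theorem weight_neg_of_mem_negTerms {U : Multiset P} {p : P} (hp : p ∈ negTerms w U) : w p < 0 :=
  not_le.1 (Multiset.mem_filter.1 hp).2

theorem nonnegTerms_eq_zero {U : Multiset P} (h : ∀ p ∈ U, w p < 0) : nonnegTerms w U = 0 :=
  Multiset.filter_eq_nil.2 fun p hp => not_le.2 (h p hp)

theorem negTerms_eq_self {U : Multiset P} (h : ∀ p ∈ U, w p < 0) : negTerms w U = U :=
  Multiset.filter_eq_self.2 fun p hp => not_le.2 (h p hp)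

theorem eq_zero_of_sum_eq_zero {A : Multiset ℤ} (hA : ∀ g ∈ A, g < 0) (h : A.sum = 0) :
    A = 0 := by
  by_contra hne
  have := Multiset.sum_lt_sum_of_nonempty (s := A) (f := id) (g := fun _ => 0) hne hA
  simp [h] at this

theorem nonnegTerms_ne_zero {U : Multiset P} (hU : U ≠ 0) (h : (U.map w).sum = 0) :
    nonnegTerms w U ≠ 0 := by
  intro h0
  have h1 := nonnegTerms_add_negTerms w U
  rw [h0, zero_add] at h1
  refine hU (Multiset.map_eq_zero.1 (eq_zero_of_sum_eq_zero ?_ h))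
  intro g hg
  obtain ⟨p, hp, rfl⟩ := Multiset.mem_map.1 hg
  rw [← h1] at hp
  exact weight_neg_of_mem_negTerms hp

theorem IsZeroSumAtom.one_le_card_nonnegTerms {U : Multiset P} (hU : IsZeroSumAtom w U) :
    1 ≤ (nonnegTerms w U).card :=
  Multiset.card_pos.2 (nonnegTerms_ne_zero hU.1 hU.2.1)

/-- Minimality depends on the weights alone: a submultiset of the weights lifts to a submultiset of
`U`. -/
theorem IsZeroSumAtom.of_map_eq {U V : Multiset P} (hU : IsZeroSumAtom w U)
    (h : V.map w = U.map w) : IsZeroSumAtom w V := by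
  have hcard : V.card = U.card := by simpa using congrArg Multiset.card h
  refine ⟨?_, by rw [h, hU.2.1], ?_⟩
  · rintro rfl
    exact hU.1 (Multiset.card_eq_zero.1 hcard.symm)
  · intro X hX hX0
    obtain ⟨Y, hY, hYX⟩ := exists_le_map_eq w (X.map w) U (h ▸ Multiset.map_le_map hX)
    have hc : Y.card = X.card := by simpa using congrArg Multiset.card hYX
    rcases hU.2.2 Y hY (by rw [hYX, hX0]) with rfl | rfl
    · exact Or.inl (Multiset.card_eq_zero.1 hc.symm)
    · exact Or.inr (Multiset.eq_of_le_of_card_le hX (by omega))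

theorem exists_isFactorization (S : Multiset P) (hS : (S.map w).sum = 0) :
    ∃ z, IsFactorization w S z := by
  induction hn : S.card using Nat.strong_induction_on generalizing S with
  | _ n ih =>
    by_cases h0 : S = 0
    · exact ⟨0, by simp, by rw [h0]; rfl⟩
    by_cases hat : IsZeroSumAtom w S
    · exact ⟨{S}, by simpa using hat, by simp⟩
    simp only [IsZeroSumAtom, not_and, not_forall, not_or] at hat
    obtain ⟨V, hV, hV0, hne, hne'⟩ := hat h0 hS
    obtain ⟨X, rfl⟩ := Multiset.le_iff_exists_add.1 hV
    rw [Multiset.map_add, Multiset.sum_add, hV0, zero_add] at hS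
    have h1 : 0 < V.card := Multiset.card_pos.2 hne
    have h2 : 0 < X.card := Multiset.card_pos.2 fun h => hne' (by rw [h, add_zero])
    rw [Multiset.card_add] at hn
    obtain ⟨z, hz, hzs⟩ := ih _ (by omega) V hV0 rfl
    obtain ⟨y, hy, hys⟩ := ih _ (by omega) X hS rfl
    refine ⟨z + y, ?_, by rw [Multiset.sum_add, hzs, hys]⟩
    intro U hU
    rcases Multiset.mem_add.1 hU with h | h
    · exact hz U h
    · exact hy U h

theorem nonnegTerms_sum (z : Multiset (Multiset P)) :
    nonnegTerms w z.sum = (z.map (nonnegTerms w)).sum := by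
  have := filter_sum_map (fun p => 0 ≤ w p) id z
  rw [Multiset.map_id] at this
  exact this

theorem negTerms_sum (z : Multiset (Multiset P)) :
    negTerms w z.sum = (z.map (negTerms w)).sum := by
  have := filter_sum_map (fun p => ¬ 0 ≤ w p) id z
  rw [Multiset.map_id] at this
  exact this

/-- Every atom uses up at least one nonnegative term. -/
theorem IsFactorization.card_le {S : Multiset P} {z : Multiset (Multiset P)}
    (hz : IsFactorization w S z) : z.card ≤ (nonnegTerms w S).card := by
  rw [← hz.2, nonnegTerms_sum, ← sum_map_card_eq]
  exact card_le_sum_map _ _ fun U hU => (hz.1 U hU).one_le_card_nonnegTerms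

/-- Partial sums of a suitable ordering of a zero-sum atom: those partial sums after which a
nonnegative term is added are distinct and lie in `(-M, 0]`. -/
theorem exists_partialSums {U : Multiset P} (hU : IsZeroSumAtom w U) {M : ℕ}
    (hM : ∀ p ∈ U, -(M : ℤ) ≤ w p) (X V : Multiset P) (hVX : V + X = U)
    (hV : -(M : ℤ) < (V.map w).sum) :
    ∃ A : Finset ℤ, A.card = (nonnegTerms w X).card ∧
      ∀ s ∈ A, -(M : ℤ) < s ∧ s ≤ 0 ∧ ∃ W, V ≤ W ∧ W < U ∧ (W.map w).sum = s := by
  induction hn : X.card using Nat.strong_induction_on generalizing X V with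
  | _ n ih =>
    have hsum : (V.map w).sum + (X.map w).sum = 0 := by
      rw [← Multiset.sum_add, ← Multiset.map_add, hVX, hU.2.1]
    -- Greedy order: a negative term is appended after a positive sum, a nonnegative one otherwise
    -- while any is left. Terms are at least `-M`, so the sum stays above `-M`.
    by_cases hpos : 0 < (V.map w).sum
    · have hx : ∃ x ∈ X, w x < 0 := by
        by_contra! hcon
        have : 0 ≤ (X.map w).sum := Multiset.sum_nonneg (by simpa using hcon)
        linarith
      obtain ⟨x, hx, hwx⟩ := hx
      obtain ⟨X, rfl⟩ := Multiset.exists_cons_of_mem hx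
      have hxM : -(M : ℤ) ≤ w x := hM x (by rw [← hVX]; simp)
      obtain ⟨A, hA, hA'⟩ := ih X.card (by rw [← hn, Multiset.card_cons]; omega) X (x ::ₘ V)
        (by rw [← hVX, Multiset.cons_add, Multiset.add_cons])
        (by rw [Multiset.map_cons, Multiset.sum_cons]; linarith) rfl
      refine ⟨A, ?_, ?_⟩
      · rw [hA, nonnegTerms, nonnegTerms, Multiset.filter_cons_of_neg (p := fun p => 0 ≤ w p) _ (not_le.2 hwx)]
      · intro s hs
        obtain ⟨h1, h2, W, h3, h4⟩ := hA' s hs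
        exact ⟨h1, h2, W, (Multiset.le_cons_self V x).trans h3, h4⟩
    · by_cases hx : ∃ x ∈ X, 0 ≤ w x
      · obtain ⟨x, hx, hwx⟩ := hx
        obtain ⟨X, rfl⟩ := Multiset.exists_cons_of_mem hx
        obtain ⟨A, hA, hA'⟩ := ih X.card (by rw [← hn, Multiset.card_cons]; omega) X (x ::ₘ V)
          (by rw [← hVX, Multiset.cons_add, Multiset.add_cons])
          (by rw [Multiset.map_cons, Multiset.sum_cons]; linarith) rfl
        -- A repeated partial sum would exhibit the block `x ::ₘ Y` between the two occurrences as a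
        -- proper nonempty zero-sum part of `U`.
        have hnot : (V.map w).sum ∉ A := by
          intro hmem
          obtain ⟨-, -, W, h3, h4, h5⟩ := hA' _ hmem
          obtain ⟨Y, rfl⟩ := Multiset.le_iff_exists_add.1 h3
          rw [Multiset.cons_add, ← Multiset.add_cons] at h4 h5
          rw [Multiset.map_add, Multiset.sum_add, add_eq_left] at h5
          have h6 : x ::ₘ Y ≤ V + x ::ₘ Y := Multiset.le_add_left _ _
          rcases hU.2.2 _ (h6.trans h4.le) h5 with h | h
          · exact Multiset.cons_ne_zero h
          · exact absurd (h ▸ h6) (not_le_of_gt h4)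
        refine ⟨insert (V.map w).sum A, ?_, ?_⟩
        · rw [Finset.card_insert_of_notMem hnot, hA, nonnegTerms, nonnegTerms,
            Multiset.filter_cons_of_pos (p := fun p => 0 ≤ w p) _ hwx, Multiset.card_cons]
        · intro s hs
          rcases Finset.mem_insert.1 hs with rfl | hs
          · refine ⟨hV, not_lt.1 hpos, V, le_rfl, ?_, rfl⟩
            rw [← hVX]
            exact lt_of_le_of_ne (Multiset.le_add_right _ _) fun h =>
              Multiset.cons_ne_zero (left_eq_add.1 h)
          · obtain ⟨h1, h2, W, h3, h4⟩ := hA' s hs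
            exact ⟨h1, h2, W, (Multiset.le_cons_self V x).trans h3, h4⟩
      · push Not at hx
        exact ⟨∅, by rw [nonnegTerms_eq_zero hx]; rfl, by simp⟩

/-- A zero-sum atom whose terms are at least `-M`, `M > 0`, has at most `M` nonnegative terms. -/
theorem IsZeroSumAtom.card_nonnegTerms_le {U : Multiset P} (hU : IsZeroSumAtom w U) {M : ℕ}
    (hM0 : 0 < M) (hM : ∀ p ∈ U, -(M : ℤ) ≤ w p) : (nonnegTerms w U).card ≤ M := by
  obtain ⟨A, hA, hA'⟩ := exists_partialSums hU hM U 0 (zero_add _) (by simpa using hM0)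
  rw [← hA]
  have : A ⊆ Finset.Ioc (-(M : ℤ)) 0 := fun s hs =>
    Finset.mem_Ioc.2 ⟨(hA' s hs).1, (hA' s hs).2.1⟩
  simpa using Finset.card_le_card this

end Weighted

/-! ### Matchings and exchanges of negative terms. -/

section Chains

variable {P : Type v} (w : P → ℤ)

/-- A replacement of a subfactorization by a not shorter one with at most `B` factors, the result
being a factorization of `S`. -/
def Step (S : Multiset P) (B : ℕ) (z z' : Multiset (Multiset P)) : Prop :=
  IsFactorization w S z' ∧ ∃ Z₁ Z₂ R, z = Z₁ + R ∧ z' = Z₂ + R ∧ Z₁.card ≤ Z₂.card ∧ Z₂.card ≤ B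

/-- Each atom of `z` is matched with a part of `y` having the same nonnegative terms. -/
def IsMatching (z y : Multiset (Multiset P))
    (C : Multiset (Multiset P × Multiset (Multiset P))) : Prop :=
  C.map Prod.fst = z ∧ (C.map Prod.snd).sum = y ∧
    ∀ c ∈ C, nonnegTerms w c.1 = nonnegTerms w c.2.sum

/-- The weights of the negative terms. -/
def negWeights (U : Multiset P) : Multiset ℤ := (negTerms w U).map w

open Classical in
/-- The weights of negative terms that the atom has in excess of its matched part. -/
noncomputable def surplus (c : Multiset P × Multiset (Multiset P)) : Multiset ℤ :=
  negWeights w c.1 - negWeights w c.2.sum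

open Classical in
/-- The weights of negative terms that the matched part has in excess of the atom. -/
noncomputable def deficit (c : Multiset P × Multiset (Multiset P)) : Multiset ℤ :=
  negWeights w c.2.sum - negWeights w c.1

variable {w}

theorem negWeights_add (U V : Multiset P) :
    negWeights w (U + V) = negWeights w U + negWeights w V := by
  simp [negWeights, negTerms_add]

theorem negWeights_sum (z : Multiset (Multiset P)) :
    negWeights w z.sum = (z.map (negWeights w)).sum := by
  have := map_sum_map w (negTerms w) z
  rw [← negTerms_sum] at this
  exact this

theorem exists_of_mem_negWeights {U : Multiset P} {g : ℤ} (hg : g ∈ negWeights w U) :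
    ∃ p ∈ U, w p = g ∧ g < 0 := by
  obtain ⟨p, hp, rfl⟩ := Multiset.mem_map.1 hg
  exact ⟨p, Multiset.mem_of_le (negTerms_le w U) hp, rfl, weight_neg_of_mem_negTerms hp⟩

theorem negWeights_neg {U : Multiset P} {g : ℤ} (hg : g ∈ negWeights w U) : g < 0 := by
  obtain ⟨p, -, -, h⟩ := exists_of_mem_negWeights hg
  exact h

theorem sum_nonnegTerms_add_sum_negWeights (U : Multiset P) :
    ((nonnegTerms w U).map w).sum + (negWeights w U).sum = (U.map w).sum := by
  rw [negWeights, ← Multiset.sum_add, ← Multiset.map_add, nonnegTerms_add_negTerms]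

theorem surplus_add (c : Multiset P × Multiset (Multiset P)) :
    surplus w c + negWeights w c.2.sum = deficit w c + negWeights w c.1 := by
  classical
  ext x
  simp only [surplus, deficit, Multiset.count_add, Multiset.count_sub]
  omega

theorem sum_map_eq_zero {S : Multiset P} {z : Multiset (Multiset P)}
    (hz : IsFactorization w S z) : (S.map w).sum = 0 := by
  have := map_sum_map w id z
  rw [Multiset.map_id, hz.2] at this
  rw [this]
  have h2 : ∀ A : Multiset (Multiset ℤ), (∀ a ∈ A, a.sum = 0) → A.sum.sum = 0 := by
    intro A
    induction A using Multiset.induction_on with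
    | empty => simp
    | cons a A ih =>
      intro h
      rw [Multiset.sum_cons, Multiset.sum_add, h a (Multiset.mem_cons_self a A),
        ih fun b hb => h b (Multiset.mem_cons_of_mem hb), add_zero]
  refine h2 _ fun a ha => ?_
  obtain ⟨U, hU, rfl⟩ := Multiset.mem_map.1 ha
  exact (hz.1 U hU).2.1

section Matching

variable {S : Multiset P} {z y : Multiset (Multiset P)}
  {C : Multiset (Multiset P × Multiset (Multiset P))}

theorem IsMatching.isZeroSumAtom_fst (hC : IsMatching w z y C) (hz : IsFactorization w S z)
    {c : Multiset P × Multiset (Multiset P)} (hc : c ∈ C) : IsZeroSumAtom w c.1 :=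
  hz.1 _ (hC.1 ▸ Multiset.mem_map_of_mem _ hc)

theorem IsMatching.snd_le (hC : IsMatching w z y C)
    {c : Multiset P × Multiset (Multiset P)} (hc : c ∈ C) : c.2 ≤ y :=
  hC.2.1 ▸ Multiset.le_sum_of_mem (Multiset.mem_map_of_mem _ hc)

theorem IsMatching.isFactorization_snd (hC : IsMatching w z y C) (hy : IsFactorization w S y)
    {c : Multiset P × Multiset (Multiset P)} (hc : c ∈ C) : IsFactorization w c.2.sum c.2 :=
  ⟨fun U hU => hy.1 U (Multiset.mem_of_le (hC.snd_le hc) hU), rfl⟩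

theorem IsMatching.fst_le (hC : IsMatching w z y C) (hz : IsFactorization w S z)
    {c : Multiset P × Multiset (Multiset P)} (hc : c ∈ C) : c.1 ≤ S := by
  rw [← hz.2, ← hC.1]
  exact Multiset.le_sum_of_mem (Multiset.mem_map_of_mem _ hc)

/-- Both sides have weight zero and share their nonnegative terms. Consequently surplus and deficit
have equal sums. -/
theorem IsMatching.sum_negWeights_eq (hC : IsMatching w z y C) (hz : IsFactorization w S z)
    (hy : IsFactorization w S y) {c : Multiset P × Multiset (Multiset P)} (hc : c ∈ C) :
    (negWeights w c.1).sum = (negWeights w c.2.sum).sum := by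
  have h1 := sum_nonnegTerms_add_sum_negWeights (w := w) c.1
  have h2 := sum_nonnegTerms_add_sum_negWeights (w := w) c.2.sum
  rw [(hC.isZeroSumAtom_fst hz hc).2.1, hC.2.2 c hc] at h1
  rw [sum_map_eq_zero (hC.isFactorization_snd hy hc)] at h2
  linarith

theorem IsMatching.sum_map_snd (hC : IsMatching w z y C) :
    (C.map fun c => c.2.sum).sum = y.sum := by
  rw [← hC.2.1]
  clear hC
  induction C using Multiset.induction_on with
  | empty => rfl
  | cons c C ih => simp [ih]

/-- Both `z` and `y` use all negative terms of `S`, so the imbalances cancel over the whole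
matching. -/
theorem IsMatching.sum_surplus_eq (hC : IsMatching w z y C) (hz : IsFactorization w S z)
    (hy : IsFactorization w S y) : (C.map (surplus w)).sum = (C.map (deficit w)).sum := by
  have h1 : (C.map fun c => negWeights w c.1).sum = negWeights w S := by
    rw [← hz.2, ← hC.1, negWeights_sum, Multiset.map_map]
    rfl
  have h2 : (C.map fun c => negWeights w c.2.sum).sum = negWeights w S := by
    rw [← hy.2, ← hC.sum_map_snd]
    have := negWeights_sum (w := w) (C.map fun c => c.2.sum)
    rw [Multiset.map_map] at this
    exact this.symm
  have h3 : (C.map fun c => surplus w c + negWeights w c.2.sum) =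
      C.map fun c => deficit w c + negWeights w c.1 :=
    Multiset.map_congr rfl fun c _ => surplus_add c
  have h4 := congrArg Multiset.sum h3
  rw [Multiset.sum_map_add, Multiset.sum_map_add, h1, h2] at h4
  exact add_right_cancel h4

/-- Existence of few exchanges between the atoms of `z` that reduce the surplus. -/
theorem IsMatching.exists_exchange (hC : IsMatching w z y C) (hz : IsFactorization w S z)
    (hy : IsFactorization w S y) {G₀ : Set ℤ} (hG : ∀ g ∈ G₀, g < 0)
    (hwG : ∀ p, w p < 0 → w p ∈ G₀) {N : ℕ} (hN : relDavenport (symmetricPairs G₀) = N)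
    (hne : ∃ c ∈ C, surplus w c ≠ 0) :
    ∃ Q : Multiset ((Multiset P × Multiset (Multiset P)) × Multiset P × Multiset P),
      Q ≠ 0 ∧ Q.card ≤ N ∧ Q.map Prod.fst ≤ C ∧
      (Q.map fun q => q.2.1).sum = (Q.map fun q => q.2.2).sum ∧
      ∀ q ∈ Q, q.2.1 ≤ negTerms w q.1.1 ∧ q.2.1 ≠ 0 ∧ q.2.1.map w ≤ surplus w q.1 ∧
        q.2.2.map w ≤ deficit w q.1 ∧ (q.2.1.map w).sum = (q.2.2.map w).sum := by
  classical
  have hG' : ∀ U : Multiset P, ∀ g ∈ negWeights w U, g ∈ G₀ := by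
    intro U g hg
    obtain ⟨p, -, rfl, hp⟩ := exists_of_mem_negWeights hg
    exact hwG p hp
  have hsum : ∀ c ∈ C, (surplus w c).sum = (deficit w c).sum := by
    intro c hc
    have h1 := congrArg Multiset.sum (surplus_add (w := w) c)
    rw [Multiset.sum_add, Multiset.sum_add, hC.sum_negWeights_eq hz hy hc] at h1
    exact add_right_cancel h1
  obtain ⟨K, hK0, hKN, hKC, hKs, hK⟩ := exists_symmetric_subpairs hG hN C (surplus w) (deficit w)
    (fun c _ g hg => hG' _ g (Multiset.mem_of_le (Multiset.sub_le_self _ _) hg))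
    (fun c _ g hg => hG' _ g (Multiset.mem_of_le (Multiset.sub_le_self _ _) hg))
    hsum (hC.sum_surplus_eq hz hy) hne
  -- So far only weights are exchanged. They are lifted to actual terms to be removed from the
  -- atoms.
  obtain ⟨E, hE, hE'⟩ := exists_map_fst_eq
    (fun (k : (Multiset P × Multiset (Multiset P)) × Multiset ℤ × Multiset ℤ) (a : Multiset P) =>
      a ≤ negTerms w k.1.1 ∧ a.map w = k.2.1) K fun k hk =>
        exists_le_map_eq w _ _ ((hK k hk).1.trans (Multiset.sub_le_self _ _))
  have hEs : (E.map Prod.snd).sum.map w = (E.map fun e => e.1.2.2).sum := by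
    rw [map_sum_map]
    have h1 : (E.map fun e => e.2.map w) = K.map fun k => k.2.1 := by
      rw [← hE, Multiset.map_map]
      exact Multiset.map_congr rfl fun e he => (hE' e he).2
    have h2 : (E.map fun e => e.1.2.2) = K.map fun k => k.2.2 := by
      rw [← hE, Multiset.map_map]
      rfl
    rw [h1, h2, hKs]
  -- The pool of removed terms has the weights of all selected deficits, so it can be dealt out
  -- again to fill them.
  obtain ⟨D, hD, hDs, hD'⟩ := exists_split_map_eq w (fun e => e.1.2.2) E _ hEs
  have hDK : (D.map Prod.fst).map Prod.fst = K := by rw [hD, hE]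
  refine ⟨D.map fun d => (d.1.1.1, d.1.2, d.2), ?_, ?_, ?_, ?_, ?_⟩
  · intro h
    rw [Multiset.map_eq_zero] at h
    rw [h] at hDK
    exact hK0 hDK.symm
  · rw [← hDK] at hKN
    simpa using hKN
  · rw [← hDK] at hKC
    simpa [Multiset.map_map, Function.comp_def] using hKC
  · rw [Multiset.map_map, Multiset.map_map]
    change (D.map fun d => d.1.2).sum = (D.map Prod.snd).sum
    rw [hDs, ← hD, Multiset.map_map]
    rfl
  · intro q hq
    obtain ⟨d, hd, rfl⟩ := Multiset.mem_map.1 hq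
    have hdE : d.1 ∈ E := hD ▸ Multiset.mem_map_of_mem _ hd
    have hdK : d.1.1 ∈ K := hE ▸ Multiset.mem_map_of_mem _ hdE
    obtain ⟨h1, h2⟩ := hE' _ hdE
    obtain ⟨h3, h4, h5, h6⟩ := hK _ hdK
    have h7 := hD' d hd
    refine ⟨h1, ?_, h2.trans_le h3, h7.trans_le h4, by rw [h2, h7, h6]⟩
    intro h0
    replace h0 : d.1.2 = 0 := h0
    rw [h0] at h2
    exact h5 h2.symm

end Matching

open Classical in
/-- The result of exchanging terms of an atom. -/
noncomputable def exchanged (q : (Multiset P × Multiset (Multiset P)) × Multiset P × Multiset P) :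
    Multiset P :=
  q.1.1 - q.2.1 + q.2.2

section Exchanged

variable {q : (Multiset P × Multiset (Multiset P)) × Multiset P × Multiset P}

theorem exchanged_add (h1 : q.2.1 ≤ negTerms w q.1.1) : exchanged q + q.2.1 = q.1.1 + q.2.2 := by
  classical
  rw [exchanged, add_right_comm, tsub_add_cancel_of_le (h1.trans (negTerms_le w _))]

theorem sum_map_exchanged (h1 : q.2.1 ≤ negTerms w q.1.1)
    (h5 : (q.2.1.map w).sum = (q.2.2.map w).sum) :
    ((exchanged q).map w).sum = (q.1.1.map w).sum := by
  have := congrArg (fun U => (U.map w).sum) (exchanged_add h1)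
  simp only [Multiset.map_add, Multiset.sum_add] at this
  linarith

theorem nonnegTerms_exchanged (h1 : q.2.1 ≤ negTerms w q.1.1)
    (h4 : q.2.2.map w ≤ deficit w q.1) : nonnegTerms w (exchanged q) = nonnegTerms w q.1.1 := by
  classical
  have h := congrArg (nonnegTerms w) (exchanged_add h1)
  rw [nonnegTerms_add, nonnegTerms_add,
    nonnegTerms_eq_zero fun p hp => weight_neg_of_mem_negTerms (Multiset.mem_of_le h1 hp),
    nonnegTerms_eq_zero (U := q.2.2) fun p hp => negWeights_neg (Multiset.mem_of_le
      (h4.trans (Multiset.sub_le_self _ _)) (Multiset.mem_map_of_mem w hp))] at h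
  simpa using h

/-- Removed weights come from the surplus and inserted ones only fill the deficit, so the surplus
drops by exactly the removed weights. -/
theorem card_surplus_exchanged (h1 : q.2.1 ≤ negTerms w q.1.1)
    (h4 : q.2.2.map w ≤ deficit w q.1) (h3 : q.2.1.map w ≤ surplus w q.1) (h2 : q.2.1 ≠ 0) :
    (surplus w (exchanged q, q.1.2)).card < (surplus w q.1).card := by
  classical
  have hA : negWeights w q.2.1 = q.2.1.map w := by
    rw [negWeights, negTerms_eq_self fun p hp =>
      weight_neg_of_mem_negTerms (Multiset.mem_of_le h1 hp)]
  have hB : negWeights w q.2.2 = q.2.2.map w := by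
    rw [negWeights, negTerms_eq_self fun p hp => negWeights_neg (Multiset.mem_of_le
      (h4.trans (Multiset.sub_le_self _ _)) (Multiset.mem_map_of_mem w hp))]
  have h := congrArg (negWeights w) (exchanged_add h1)
  rw [negWeights_add, negWeights_add, hA, hB] at h
  have hle : q.2.1.map w ≤ negWeights w q.1.1 := h3.trans (Multiset.sub_le_self _ _)
  have hE : negWeights w (exchanged q) = negWeights w q.1.1 - q.2.1.map w + q.2.2.map w := by
    rw [tsub_add_eq_add_tsub hle, ← h, add_tsub_cancel_right]
  have hs : surplus w (exchanged q, q.1.2) = surplus w q.1 - q.2.1.map w := by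
    rw [surplus, hE]
    exact exchange_sub h3 h4
  rw [hs, Multiset.card_sub h3, Multiset.card_map]
  have h6 := Multiset.card_le_card h3
  have h7 := Multiset.card_pos.2 h2
  rw [Multiset.card_map] at h6
  omega

end Exchanged

/-- As long as there is a surplus, a step leads to a longer factorization, or to one of the same
length with smaller surplus. -/
theorem IsMatching.exists_step {S : Multiset P} {z y : Multiset (Multiset P)}
    {C : Multiset (Multiset P × Multiset (Multiset P))}
    (hC : IsMatching w z y C) (hz : IsFactorization w S z)
    (hy : IsFactorization w S y) {G₀ : Set ℤ} (hG : ∀ g ∈ G₀, g < 0)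
    (hwG : ∀ p, w p < 0 → w p ∈ G₀) {N : ℕ} (hN : relDavenport (symmetricPairs G₀) = N)
    {M : ℕ} (hM : ∀ p ∈ S, -(M : ℤ) ≤ w p) {B : ℕ} (hB : M * N ≤ B)
    (hne : ∃ c ∈ C, surplus w c ≠ 0) :
    ∃ z', Step w S B z z' ∧ (z.card < z'.card ∨ z.card = z'.card ∧ ∃ C', IsMatching w z' y C' ∧
      (C'.map fun c => (surplus w c).card).sum < (C.map fun c => (surplus w c).card).sum) := by
  classical
  obtain ⟨Q, hQ0, hQN, hQC, hQs, hQ⟩ := hC.exists_exchange hz hy hG hwG hN hne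
  obtain ⟨C₀, rfl⟩ := Multiset.le_iff_exists_add.1 hQC
  have hmem : ∀ q ∈ Q, q.1 ∈ Q.map Prod.fst + C₀ := fun q hq =>
    Multiset.mem_of_le hQC (Multiset.mem_map_of_mem _ hq)
  have hat : ∀ q ∈ Q, IsZeroSumAtom w q.1.1 := fun q hq => hC.isZeroSumAtom_fst hz (hmem q hq)
  have hzero : ∀ q ∈ Q, ((exchanged q).map w).sum = 0 := fun q hq => by
    rw [sum_map_exchanged (hQ q hq).1 (hQ q hq).2.2.2.2, (hat q hq).2.1]
  have hF : ∀ q ∈ Q, ∃ F, IsFactorization w (exchanged q) F := fun q hq =>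
    exists_isFactorization _ (hzero q hq)
  choose! F hF using hF
  have hnn : ∀ q ∈ Q, nonnegTerms w (exchanged q) = nonnegTerms w q.1.1 := fun q hq =>
    nonnegTerms_exchanged (hQ q hq).1 (hQ q hq).2.2.2.1
  -- An exchanged multiset keeps the nonnegative terms of its atom, so it is nonempty.
  have hF1 : ∀ q ∈ Q, 1 ≤ (F q).card := by
    intro q hq
    refine Multiset.card_pos.2 fun h0 => ?_
    have h1 := (hF q hq).2
    rw [h0, Multiset.sum_zero] at h1
    have h2 := hnn q hq
    rw [← h1] at h2
    have h3 := (hat q hq).one_le_card_nonnegTerms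
    rw [← h2] at h3
    simp [nonnegTerms] at h3
  have hFM : ∀ q ∈ Q, (F q).card ≤ M := by
    intro q hq
    refine (hF q hq).card_le.trans ?_
    rw [hnn q hq]
    have hle := hC.fst_le hz (hmem q hq)
    refine (hat q hq).card_nonnegTerms_le ?_ fun p hp => hM p (Multiset.mem_of_le hle hp)
    -- A removed term has negative weight at least `-M`, which forces `0 < M`.
    obtain ⟨p, hp⟩ := Multiset.exists_mem_of_ne_zero (hQ q hq).2.1
    have hp' := Multiset.mem_of_le (hQ q hq).1 hp
    have h1 := hM p (Multiset.mem_of_le ((negTerms_le w _).trans hle) hp')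
    have h2 := weight_neg_of_mem_negTerms hp'
    omega
  have hz1 : z = Q.map (fun q => q.1.1) + C₀.map Prod.fst := by
    rw [← hC.1, Multiset.map_add, Multiset.map_map]
    rfl
  have hcard : (Q.map F).sum.card = (Q.map fun q => (F q).card).sum := (sum_map_card_eq F Q).symm
  have hcard1 : (Q.map fun q => q.1.1).card ≤ (Q.map F).sum.card := by
    rw [hcard, Multiset.card_map]
    exact card_le_sum_map _ Q hF1
  have hcard2 : (Q.map F).sum.card ≤ B := by
    rw [hcard]
    have h1 := Multiset.sum_le_card_nsmul (Q.map fun q => (F q).card) M fun n hn => by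
      obtain ⟨q, hq, rfl⟩ := Multiset.mem_map.1 hn
      exact hFM q hq
    rw [Multiset.card_map, smul_eq_mul] at h1
    exact h1.trans ((Nat.mul_le_mul_right M hQN).trans (by rwa [mul_comm]))
  have hsum1 : (Q.map F).sum.sum = (Q.map exchanged).sum := by
    have : Q.map exchanged = Q.map fun q => (F q).sum :=
      Multiset.map_congr rfl fun q hq => (hF q hq).2.symm
    rw [this]
    clear * -
    induction Q using Multiset.induction_on with
    | empty => rfl
    | cons q Q ih => simp [ih]
  -- The exchange only moves terms between the chosen atoms, so their total is unchanged.
  have hsum2 : (Q.map exchanged).sum = (Q.map fun q => q.1.1).sum := by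
    have h1 : (Q.map fun q => exchanged q + q.2.1) = Q.map fun q => q.1.1 + q.2.2 :=
      Multiset.map_congr rfl fun q hq => exchanged_add (hQ q hq).1
    have h2 := congrArg Multiset.sum h1
    rw [Multiset.sum_map_add, Multiset.sum_map_add, hQs] at h2
    exact add_right_cancel h2
  have hfac : IsFactorization w S ((Q.map F).sum + C₀.map Prod.fst) := by
    refine ⟨?_, ?_⟩
    · intro U hU
      rcases Multiset.mem_add.1 hU with hU | hU
      · obtain ⟨s, hs, hUs⟩ := Multiset.mem_join.1 hU
        obtain ⟨q, hq, rfl⟩ := Multiset.mem_map.1 hs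
        exact (hF q hq).1 U hUs
      · exact hz.1 U (hz1 ▸ Multiset.mem_add.2 (Or.inr hU))
    · rw [Multiset.sum_add, hsum1, hsum2, ← Multiset.sum_add, ← hz1, hz.2]
  refine ⟨(Q.map F).sum + C₀.map Prod.fst,
    ⟨hfac, _, _, _, hz1, rfl, hcard1, hcard2⟩, ?_⟩
  rcases hcard1.lt_or_eq with hlt | heq
  · left
    rw [hz1, Multiset.card_add, Multiset.card_add]
    omega
  right
  refine ⟨by rw [hz1, Multiset.card_add, Multiset.card_add, heq], ?_⟩
  rw [hcard, Multiset.card_map] at heq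
  -- Without a gain in length every exchanged multiset is itself an atom and can keep its matched
  -- part of `y`.
  have hFone := eq_one_of_sum_map_le_card _ Q hF1 heq.ge
  have hFeq : ∀ q ∈ Q, F q = {exchanged q} := by
    intro q hq
    obtain ⟨U, hU⟩ := Multiset.card_eq_one.1 (hFone q hq)
    have := (hF q hq).2
    rw [hU, Multiset.sum_singleton] at this
    rw [hU, this]
  have hsumF : (Q.map F).sum = Q.map exchanged := by
    rw [Multiset.map_congr rfl hFeq]
    clear * -
    induction Q using Multiset.induction_on with
    | empty => rfl
    | cons q Q ih => simp [ih]
  refine ⟨Q.map (fun q => (exchanged q, q.1.2)) + C₀, ⟨?_, ?_, ?_⟩, ?_⟩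
  · rw [hsumF, Multiset.map_add, Multiset.map_map]
    rfl
  · rw [← hC.2.1, Multiset.map_add, Multiset.map_add, Multiset.map_map, Multiset.map_map]
    rfl
  · intro c hc
    rcases Multiset.mem_add.1 hc with hc | hc
    · obtain ⟨q, hq, rfl⟩ := Multiset.mem_map.1 hc
      exact (hnn q hq).trans (hC.2.2 _ (hmem q hq))
    · exact hC.2.2 c (Multiset.mem_add.2 (Or.inr hc))
  · rw [Multiset.map_add, Multiset.map_add, Multiset.sum_add, Multiset.sum_add,
      Multiset.map_map, Multiset.map_map]
    refine Nat.add_lt_add_right (Multiset.sum_lt_sum_of_nonempty hQ0 fun q hq => ?_) _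
    obtain ⟨h1, h2, h3, h4, -⟩ := hQ q hq
    exact card_surplus_exchanged h1 h4 h3 h2

end Chains

/-! ### Chains to factorizations of maximal length -/

section Chains

variable {P : Type v} {w : P → ℤ} {S : Multiset P} {B : ℕ}

/-- Atoms of `y` correspond to nonnegative terms of `S`, so the nonnegative terms of an atom of `z`
select its part of `y`. -/
theorem exists_isMatching {z y : Multiset (Multiset P)} (hz : IsFactorization w S z)
    (hy : IsFactorization w S y) (hy1 : ∀ V ∈ y, (nonnegTerms w V).card = 1) :
    ∃ C, IsMatching w z y C := by
  have h1 : y.map (nonnegTerms w) =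
      (z.map fun U => (nonnegTerms w U).map fun p => ({p} : Multiset P)).sum := by
    rw [eq_map_singleton_sum (y.map (nonnegTerms w)) (by simpa using hy1), ← nonnegTerms_sum, hy.2,
      ← hz.2, nonnegTerms_sum, map_sum_map]
  obtain ⟨C, h2, h3, h4⟩ := exists_split_map_eq (nonnegTerms w)
    (fun U => (nonnegTerms w U).map fun p => ({p} : Multiset P)) z y h1
  refine ⟨C, h2, h3, fun c hc => ?_⟩
  rw [nonnegTerms_sum, h4 c hc, Multiset.sum_map_singleton]

/-- Lexicographic induction on the gap `n` to the maximal possible length and the total surplus `m`.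
When the length grows, a new matching is chosen and `m` may be arbitrary. -/
theorem exists_matching_without_surplus {y : Multiset (Multiset P)}
    (hy : IsFactorization w S y) (hy1 : ∀ V ∈ y, (nonnegTerms w V).card = 1)
    {G₀ : Set ℤ} (hG : ∀ g ∈ G₀, g < 0)
    (hwG : ∀ p, w p < 0 → w p ∈ G₀) {N : ℕ} (hN : relDavenport (symmetricPairs G₀) = N)
    {M : ℕ} (hM : ∀ p ∈ S, -(M : ℤ) ≤ w p) (hB : M * N ≤ B) (n m : ℕ) :
    ∀ z C, IsFactorization w S z → IsMatching w z y C → (nonnegTerms w S).card - z.card = n →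
      (C.map fun c => (surplus w c).card).sum = m →
      ∃ z' C', Relation.ReflTransGen (Step w S B) z z' ∧ IsFactorization w S z' ∧
        IsMatching w z' y C' ∧ ∀ c ∈ C', surplus w c = 0 := by
  induction n using Nat.strong_induction_on generalizing m with
  | _ n ihn =>
  induction m using Nat.strong_induction_on with
  | _ m ihm =>
  intro z C hz hC hn hm
  by_cases hne : ∃ c ∈ C, surplus w c ≠ 0
  · obtain ⟨z', hstep, h⟩ := hC.exists_step hz hy hG hwG hN hM hB hne
    have hz' := hstep.1
    rcases h with hlt | ⟨heq, C', hC', hlt⟩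
    · obtain ⟨C', hC'⟩ := exists_isMatching hz' hy hy1
      have := hz'.card_le
      obtain ⟨x, D, hx, hxD⟩ := ihn _ (by omega) _ z' C' hz' hC' rfl rfl
      exact ⟨x, D, hx.head hstep, hxD⟩
    · obtain ⟨x, D, hx, hxD⟩ := ihm _ (by omega) z' C' hz' hC' (by omega) rfl
      exact ⟨x, D, hx.head hstep, hxD⟩
  · push Not at hne
    exact ⟨z, C, .refl, hz, hC, hne⟩

/-- Without surplus the deficit consists of negative numbers with sum zero, so it is empty. The
matched part then has the weights of an atom; its sum is an atom and cannot split. -/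
theorem IsMatching.snd_eq_singleton {z y : Multiset (Multiset P)}
    {C : Multiset (Multiset P × Multiset (Multiset P))} (hC : IsMatching w z y C)
    (hz : IsFactorization w S z) (hy : IsFactorization w S y)
    {c : Multiset P × Multiset (Multiset P)} (hc : c ∈ C) (h0 : surplus w c = 0) :
    c.1.map w = c.2.sum.map w ∧ c.2 = {c.2.sum} := by
  classical
  have hneg : negWeights w c.1 = negWeights w c.2.sum := by
    have h1 : negWeights w c.1 ≤ negWeights w c.2.sum := tsub_eq_zero_iff_le.1 h0
    obtain ⟨A, hA⟩ := Multiset.le_iff_exists_add.1 h1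
    have h2 := hC.sum_negWeights_eq hz hy hc
    rw [hA, Multiset.sum_add, left_eq_add] at h2
    have h3 : A = 0 := eq_zero_of_sum_eq_zero (fun g hg => negWeights_neg (U := c.2.sum)
      (hA ▸ Multiset.mem_add.2 (Or.inr hg))) h2
    rw [hA, h3, add_zero]
  have hmap : c.1.map w = c.2.sum.map w := by
    rw [← nonnegTerms_add_negTerms w c.1, ← nonnegTerms_add_negTerms w c.2.sum, Multiset.map_add,
      Multiset.map_add, hC.2.2 c hc]
    exact congrArg _ hneg
  refine ⟨hmap, ?_⟩
  have hat : IsZeroSumAtom w c.2.sum := (hC.isZeroSumAtom_fst hz hc).of_map_eq hmap.symm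
  have hfac := hC.isFactorization_snd hy hc
  have hne : c.2 ≠ 0 := fun h => hat.1 (by rw [h, Multiset.sum_zero])
  obtain ⟨V, hV⟩ := Multiset.exists_mem_of_ne_zero hne
  have hVle : V ≤ c.2.sum := Multiset.le_sum_of_mem hV
  rcases hat.2.2 V hVle (hfac.1 V hV).2.1 with h | h
  · exact absurd h (hfac.1 V hV).1
  · obtain ⟨Y, hY⟩ := Multiset.exists_cons_of_mem hV
    rw [← h]
    rw [hY, Multiset.sum_cons, left_eq_add] at h
    have : Y = 0 := by
      refine Multiset.eq_zero_of_forall_notMem fun W hW => ?_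
      have h1 : W ≤ Y.sum := Multiset.le_sum_of_mem hW
      rw [h, Multiset.le_zero] at h1
      exact (hfac.1 W (hY ▸ Multiset.mem_cons_of_mem hW)).1 h1
    rw [hY, this]
    rfl

open Classical in
/-- Swapping two terms of equal weight between two atoms. -/
theorem exists_swap (hB : 2 ≤ B) {D : Multiset (Multiset P × Multiset P)}
    (hD : ∀ d ∈ D, d.1.map w = d.2.map w) (hz : IsFactorization w S (D.map Prod.fst))
    (hs : (D.map Prod.snd).sum = S) (hne : ∃ d ∈ D, d.1 ≠ d.2) :
    ∃ D' : Multiset (Multiset P × Multiset P), (∀ d ∈ D', d.1.map w = d.2.map w) ∧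
      Step w S B (D.map Prod.fst) (D'.map Prod.fst) ∧ D'.map Prod.snd = D.map Prod.snd ∧
      (D'.map fun d => (d.1 - d.2).card).sum < (D.map fun d => (d.1 - d.2).card).sum := by
  obtain ⟨⟨U, V⟩, hd, hUV⟩ := hne
  replace hUV : U ≠ V := hUV
  obtain ⟨D, rfl⟩ := Multiset.exists_cons_of_mem hd
  have hUVw : U.map w = V.map w := hD _ hd
  have hcard : U.card = V.card := by simpa using congrArg Multiset.card hUVw
  have hVU : V - U ≠ 0 := fun h =>
    hUV (Multiset.eq_of_le_of_card_le (tsub_eq_zero_iff_le.1 h) hcard.le).symm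
  obtain ⟨q', hq'⟩ := Multiset.exists_mem_of_ne_zero hVU
  have hdiff : (U - V).map w = (V - U).map w := by
    have h1 : U - V + V = V - U + U := by
      ext x
      simp only [Multiset.count_add, Multiset.count_sub]
      omega
    have h2 := congrArg (Multiset.map w) h1
    rw [Multiset.map_add, Multiset.map_add, hUVw] at h2
    exact add_right_cancel h2
  -- `U - V` and `V - U` have the same weights, so the missing term `q'` has a superfluous partner
  -- `q` of equal weight.
  obtain ⟨q, hq, hqq⟩ := Multiset.mem_map.1 (hdiff ▸ Multiset.mem_map_of_mem w hq')
  have hcount : V.count q' > U.count q' := by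
    have := Multiset.count_pos.2 hq'
    rw [Multiset.count_sub] at this
    omega
  -- The first and second components have the same total, so a lack of `q'` in `U` is offset by an
  -- excess in another pair.
  have hex : ∃ d ∈ D, d.2.count q' < d.1.count q' := by
    by_contra! hcon
    have h1 := hz.2.trans hs.symm
    have h2 := congrArg (Multiset.count q') h1
    simp only [Multiset.map_cons, Multiset.sum_cons, Multiset.count_add, Multiset.count_sum] at h2
    have h3 := Multiset.sum_map_le_sum_map _ _ hcon
    omega
  obtain ⟨⟨U', V'⟩, hd', hcount'⟩ := hex
  replace hcount' : V'.count q' < U'.count q' := hcount'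
  obtain ⟨D, rfl⟩ := Multiset.exists_cons_of_mem hd'
  have hUVw' : U'.map w = V'.map w := hD _ (Multiset.mem_cons_of_mem hd')
  have hqU : q ∈ U := Multiset.mem_of_le (Multiset.sub_le_self _ _) hq
  have hqU' : q' ∈ U' := Multiset.count_pos.1 (by omega)
  obtain ⟨X, rfl⟩ := Multiset.exists_cons_of_mem hqU
  obtain ⟨X', rfl⟩ := Multiset.exists_cons_of_mem hqU'
  have hw1 : (q' ::ₘ X).map w = (q ::ₘ X).map w := by simp [hqq]
  have hw2 : (q ::ₘ X').map w = (q' ::ₘ X').map w := by simp [hqq]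
  have hqV : V.count q < (q ::ₘ X).count q := by
    have := Multiset.count_pos.2 hq
    rw [Multiset.count_sub] at this
    omega
  have hqq' : q ≠ q' := by
    rintro rfl
    omega
  have hc1 : (q' ::ₘ X - V).card + 1 = (q ::ₘ X - V).card := by
    rw [← Multiset.card_cons q]
    congr 1
    ext x
    simp only [Multiset.count_cons, Multiset.count_sub] at *
    by_cases hxq : x = q
    · subst hxq
      simp only [if_neg hqq', if_true] at *
      omega
    · by_cases hxq' : x = q'
      · subst hxq'
        simp only [if_neg hxq, if_true] at *
        omega
      · simp [hxq, hxq']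
  -- The second pair gives up an excess `q'`, which pays for a possibly unwanted `q`.
  have hc2 : (q ::ₘ X' - V').card ≤ (q' ::ₘ X' - V').card := by
    have h1 : q' ::ₘ X' - V' = q' ::ₘ (X' - V') := by
      ext x
      simp only [Multiset.count_cons, Multiset.count_sub] at *
      by_cases hxq' : x = q'
      · subst hxq'
        simp only [if_true] at *
        omega
      · simp [hxq']
    have h2 : q ::ₘ X' - V' ≤ q ::ₘ (X' - V') := by
      rw [Multiset.le_iff_count]
      intro x
      simp only [Multiset.count_cons, Multiset.count_sub]
      omega
    rw [h1, Multiset.card_cons, ← Multiset.card_cons q]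
    exact Multiset.card_le_card h2
  refine ⟨(q' ::ₘ X, V) ::ₘ (q ::ₘ X', V') ::ₘ D, ?_, ⟨⟨?_, ?_⟩,
    {q ::ₘ X, q' ::ₘ X'}, {q' ::ₘ X, q ::ₘ X'}, D.map Prod.fst, ?_, ?_, ?_, ?_⟩, ?_, ?_⟩
  · intro d hd
    rcases Multiset.mem_cons.1 hd with rfl | hd
    · exact hw1.trans hUVw
    rcases Multiset.mem_cons.1 hd with rfl | hd
    · exact hw2.trans hUVw'
    · exact hD d (Multiset.mem_cons_of_mem (Multiset.mem_cons_of_mem hd))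
  · intro W hW
    simp only [Multiset.map_cons, Multiset.mem_cons] at hW
    rcases hW with rfl | rfl | hW
    · exact (hz.1 (q ::ₘ X) (by simp)).of_map_eq hw1
    · exact (hz.1 (q' ::ₘ X') (by simp)).of_map_eq hw2
    · exact hz.1 W (by
        simp only [Multiset.map_cons, Multiset.mem_cons]
        exact Or.inr (Or.inr hW))
  · rw [← hz.2]
    simp only [Multiset.map_cons, Multiset.sum_cons]
    simp only [← Multiset.singleton_add]
    abel
  · simp
  · simp
  · simp
  · simpa using hB
  · simp
  · simp only [Multiset.map_cons, Multiset.sum_cons]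
    omega

-- Each swap lowers the number of terms in which paired atoms differ. It replaces two atoms by two,
-- so the length stays constant.
open Classical in
theorem reflTransGen_of_map_eq (hB : 2 ≤ B) (n : ℕ) :
    ∀ D : Multiset (Multiset P × Multiset P), (∀ d ∈ D, d.1.map w = d.2.map w) →
      IsFactorization w S (D.map Prod.fst) → (D.map Prod.snd).sum = S →
      (D.map fun d => (d.1 - d.2).card).sum = n →
      Relation.ReflTransGen (Step w S B) (D.map Prod.fst) (D.map Prod.snd) := by
  induction n using Nat.strong_induction_on with
  | _ n ih =>
  intro D hD hz hs hn
  by_cases hne : ∃ d ∈ D, d.1 ≠ d.2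
  · obtain ⟨D', h1, h2, h3, h4⟩ := exists_swap hB hD hz hs hne
    have := ih _ (hn ▸ h4) D' h1 h2.1 (h3 ▸ hs) rfl
    rw [h3] at this
    exact this.head h2
  · push Not at hne
    rw [Multiset.map_congr rfl hne]

/-- A factorization of the maximal possible length is reached from every other one by steps of
bounded size. -/
theorem reflTransGen_step {z y : Multiset (Multiset P)} (hz : IsFactorization w S z)
    (hy : IsFactorization w S y) (hcard : y.card = (nonnegTerms w S).card)
    {G₀ : Set ℤ} (hG : ∀ g ∈ G₀, g < 0)
    (hwG : ∀ p, w p < 0 → w p ∈ G₀) {N : ℕ} (hN : relDavenport (symmetricPairs G₀) = N)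
    {M : ℕ} (hM : ∀ p ∈ S, -(M : ℤ) ≤ w p) (hB : M * N ≤ B) (hB2 : 2 ≤ B) :
    Relation.ReflTransGen (Step w S B) z y := by
  -- `y` attains the bound of `IsFactorization.card_le`, so no atom of `y` has a second nonnegative
  -- term.
  have hy1 : ∀ V ∈ y, (nonnegTerms w V).card = 1 := by
    refine eq_one_of_sum_map_le_card (fun V => (nonnegTerms w V).card) y
      (fun V hV => (hy.1 V hV).one_le_card_nonnegTerms) ?_
    rw [sum_map_card_eq, ← nonnegTerms_sum, hy.2, hcard]
  obtain ⟨C, hC⟩ := exists_isMatching hz hy hy1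
  obtain ⟨x, C, hzx, hx, hC, hC0⟩ :=
    exists_matching_without_surplus hy hy1 hG hwG hN hM hB _ _ z C hz hC rfl rfl
  have h1 : (C.map fun c => (c.1, c.2.sum)).map Prod.fst = x := by
    rw [Multiset.map_map, ← hC.1]
    rfl
  have h2 : (C.map fun c => (c.1, c.2.sum)).map Prod.snd = y := by
    rw [← hC.2.1, Multiset.map_congr rfl fun c hc => (hC.snd_eq_singleton hx hy hc (hC0 c hc)).2,
      Multiset.map_map, ← Multiset.sum_map_singleton (Multiset.map _ _), Multiset.map_map]
    rfl
  refine hzx.trans ?_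
  have := reflTransGen_of_map_eq (w := w) (S := S) hB2 _ (C.map fun c => (c.1, c.2.sum)) ?_
    (h1 ▸ hx) (by rw [h2, hy.2]) rfl
  · rwa [h1, h2] at this
  · intro d hd
    obtain ⟨c, hc, rfl⟩ := Multiset.mem_map.1 hd
    exact (hC.snd_eq_singleton hx hy hc (hC0 c hc)).1

end Chains

open Algebra

/-! ### Transfer to factorizations in the monoid -/

section Transfer

variable {H : Type u} [CancelCommMonoid H] {P : Type v} (φ : H →* FreeAb P)

/-- The class of a prime divisor as an integer. -/
def primeWeight (e : ClassGrp φ ≃+ ℤ) (p : P) : ℤ := e (cls φ (FreeAb.of p))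

theorem terms_preBlockHom (e : ClassGrp φ ≃+ ℤ) (S : FreeAb P) :
    terms (preBlockHom φ e S) = (Multiplicative.toAdd S).map (primeWeight φ e) := by
  rw [terms_eq_map]
  exact Multiset.map_map _ _ _

theorem sum_map_primeWeight (e : ClassGrp φ ≃+ ℤ) (S : FreeAb P) :
    ((Multiplicative.toAdd S).map (primeWeight φ e)).sum = e (cls φ S) := by
  rw [← seqSum_preBlockHom, seqSum, terms_preBlockHom]

theorem apply_eq_one_of_isUnit {a : H} (ha : IsUnit a) : φ a = 1 := by
  obtain ⟨b, hb⟩ := ha.exists_right_inv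
  have h1 : Multiplicative.toAdd (φ a) + Multiplicative.toAdd (φ b) = 0 := by
    rw [← toAdd_mul, ← map_mul, hb, map_one, toAdd_one]
  exact (add_eq_zero.1 h1).1

/-- The multiset of prime divisors of a class of associated elements. -/
def divisorOf (x : Associates H) : Multiset P :=
  Quotient.liftOn x (fun a => Multiplicative.toAdd (φ a)) fun a b h => by
    obtain ⟨c, rfl⟩ := h
    rw [map_mul, apply_eq_one_of_isUnit φ c.isUnit, mul_one]

theorem divisorOf_mk (a : H) : divisorOf φ (Associates.mk a) = Multiplicative.toAdd (φ a) := rfl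

theorem divisorOf_one : divisorOf φ 1 = 0 := by
  rw [← Associates.mk_one, divisorOf_mk, map_one, toAdd_one]

theorem divisorOf_mul (x y : Associates H) :
    divisorOf φ (x * y) = divisorOf φ x + divisorOf φ y := by
  obtain ⟨a, rfl⟩ := Associates.mk_surjective x
  obtain ⟨b, rfl⟩ := Associates.mk_surjective y
  rw [Associates.mk_mul_mk, divisorOf_mk, map_mul, toAdd_mul]; rfl

theorem divisorOf_prod (z : Multiset (Associates H)) :
    divisorOf φ z.prod = (z.map (divisorOf φ)).sum := by
  induction z using Multiset.induction_on with
  | empty => exact divisorOf_one φ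
  | cons x z ih => rw [Multiset.prod_cons, divisorOf_mul, ih, Multiset.map_cons, Multiset.sum_cons]

variable {φ}

/-- Equal images divide each other, so the elements do too; by cancellation they are associated. -/
theorem divisorOf_injective (hdiv : IsDivisorHom φ) : Function.Injective (divisorOf φ) := by
  intro x y h
  obtain ⟨a, rfl⟩ := Associates.mk_surjective x
  obtain ⟨b, rfl⟩ := Associates.mk_surjective y
  replace h : φ a = φ b := h
  obtain ⟨c, hc⟩ := hdiv a b (dvd_of_eq h)
  obtain ⟨d, hd⟩ := hdiv b a (dvd_of_eq h.symm)
  have h1 : c * d = 1 := by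
    rw [hc, mul_assoc] at hd
    exact left_eq_mul.1 hd
  exact Associates.mk_eq_mk_iff_associated.2 ⟨⟨c, d, h1, by rwa [mul_comm]⟩, hc.symm⟩

/-- An element of the generated subgroup is a quotient of values of `φ`, so `S * φ b = φ a`. Then
`b` divides `a`, and the cofactor has image `S`. -/
theorem exists_apply_eq (hdiv : IsDivisorHom φ) {S : FreeAb P} (hS : cls φ S = 0) :
    ∃ a, φ a = S := by
  have h1 : GrothendieckGroup.of S ∈
      Subgroup.closure (Set.range fun h : H => GrothendieckGroup.of (φ h)) :=
    (QuotientGroup.eq_one_iff _).1 hS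
  have h2 : ∀ g ∈ Subgroup.closure (Set.range fun h : H => GrothendieckGroup.of (φ h)),
      ∃ a b : H, g * GrothendieckGroup.of (φ b) = GrothendieckGroup.of (φ a) := by
    intro g hg
    induction hg using Subgroup.closure_induction with
    | mem x hx =>
      obtain ⟨a, rfl⟩ := hx
      exact ⟨a, 1, by simp⟩
    | one => exact ⟨1, 1, by simp⟩
    | mul x y _ _ hx hy =>
      obtain ⟨a, b, hab⟩ := hx
      obtain ⟨c, d, hcd⟩ := hy
      refine ⟨a * c, b * d, ?_⟩
      rw [map_mul, map_mul, map_mul, map_mul, mul_mul_mul_comm, hab, hcd]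
    | inv x _ hx =>
      obtain ⟨a, b, hab⟩ := hx
      exact ⟨b, a, by rw [← hab, inv_mul_cancel_left]⟩
  obtain ⟨a, b, hab⟩ := h2 _ h1
  rw [← map_mul] at hab
  have h3 : S * φ b = φ a := GrothendieckGroup.of_injective hab
  obtain ⟨c, rfl⟩ := hdiv b a ⟨S, by rw [← h3, mul_comm]⟩
  refine ⟨c, ?_⟩
  rw [map_mul, mul_comm] at h3
  exact (mul_left_cancel h3).symm

theorem exists_divisorOf_eq (hdiv : IsDivisorHom φ) (e : ClassGrp φ ≃+ ℤ) {S : Multiset P}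
    (hS : (S.map (primeWeight φ e)).sum = 0) : ∃ x, divisorOf φ x = S := by
  obtain ⟨a, ha⟩ := exists_apply_eq hdiv (S := Multiplicative.ofAdd S)
    (e.map_eq_zero_iff.1 ((sum_map_primeWeight φ e _).symm.trans hS))
  exact ⟨Associates.mk a, congrArg Multiplicative.toAdd ha⟩

theorem sum_divisorOf (e : ClassGrp φ ≃+ ℤ) (x : Associates H) :
    ((divisorOf φ x).map (primeWeight φ e)).sum = 0 := by
  obtain ⟨a, rfl⟩ := Associates.mk_surjective x
  rw [divisorOf_mk, sum_map_primeWeight, cls_apply, map_zero]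

/-- `divisorOf φ` identifies the reduced monoid with all multisets over `P` of weight zero. Working
over `P` rather than over the classes keeps different primes of one class apart. -/
theorem irreducible_iff_isZeroSumAtom (hdiv : IsDivisorHom φ) (e : ClassGrp φ ≃+ ℤ)
    (x : Associates H) : Irreducible x ↔ IsZeroSumAtom (primeWeight φ e) (divisorOf φ x) := by
  have hone : ∀ y : Associates H, IsUnit y ↔ divisorOf φ y = 0 := by
    intro y
    rw [Associates.isUnit_iff_eq_one, ← divisorOf_one φ, (divisorOf_injective hdiv).eq_iff]
  constructor
  · intro hx
    refine ⟨fun h => hx.not_isUnit ((hone x).2 h), sum_divisorOf e x, fun V hV hV0 => ?_⟩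
    obtain ⟨X, hX⟩ := Multiset.le_iff_exists_add.1 hV
    have hX0 := sum_divisorOf e x
    rw [hX, Multiset.map_add, Multiset.sum_add, hV0, zero_add] at hX0
    obtain ⟨a, rfl⟩ := exists_divisorOf_eq hdiv e hV0
    obtain ⟨b, rfl⟩ := exists_divisorOf_eq hdiv e hX0
    rw [← divisorOf_mul] at hX
    rcases hx.isUnit_or_isUnit (divisorOf_injective hdiv hX) with h | h
    · exact Or.inl ((hone a).1 h)
    · rw [hX, divisorOf_mul, (hone b).1 h, add_zero]
      exact Or.inr rfl
  · intro hx
    refine irreducible_iff.2 ⟨fun h => hx.1 ((hone x).1 h), fun a b hab => ?_⟩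
    have h1 : divisorOf φ x = divisorOf φ a + divisorOf φ b := by rw [hab, divisorOf_mul]
    rcases hx.2.2 (divisorOf φ a) (h1 ▸ Multiset.le_add_right _ _) (sum_divisorOf e a) with h | h
    · exact Or.inl ((hone a).2 h)
    · rw [← h, left_eq_add] at h1
      exact Or.inr ((hone b).2 h1)

/-- The multiset of divisors of the atoms of a factorization. -/
def divisorsOf (φ : H →* FreeAb P) (z : Factorization H) : Multiset (Multiset P) :=
  z.map fun x => divisorOf φ x.1

theorem divisorsOf_injective (hdiv : IsDivisorHom φ) : Function.Injective (divisorsOf φ) :=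
  Multiset.map_injective ((divisorOf_injective hdiv).comp Subtype.val_injective)

theorem card_divisorsOf (z : Factorization H) : (divisorsOf φ z).card = z.card :=
  Multiset.card_map _ _

theorem isFactorization_divisorsOf_iff (hdiv : IsDivisorHom φ) (e : ClassGrp φ ≃+ ℤ) (a : H)
    (z : Factorization H) :
    IsFactorization (primeWeight φ e) (Multiplicative.toAdd (φ a)) (divisorsOf φ z) ↔
      z ∈ factorizations a := by
  have h1 : (divisorsOf φ z).sum = divisorOf φ (z.map Subtype.val).prod := by
    rw [divisorOf_prod, Multiset.map_map]
    rfl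
  have h2 : ∀ U ∈ divisorsOf φ z, IsZeroSumAtom (primeWeight φ e) U := by
    intro U hU
    obtain ⟨x, -, rfl⟩ := Multiset.mem_map.1 hU
    exact (irreducible_iff_isZeroSumAtom hdiv e x.1).1 x.2
  rw [IsFactorization, h1, ← divisorOf_mk, (divisorOf_injective hdiv).eq_iff]
  exact and_iff_right h2

theorem exists_divisorsOf_eq (hdiv : IsDivisorHom φ) (e : ClassGrp φ ≃+ ℤ)
    {z : Multiset (Multiset P)} (hz : ∀ U ∈ z, IsZeroSumAtom (primeWeight φ e) U) :
    ∃ x : Factorization H, divisorsOf φ x = z := by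
  induction z using Multiset.induction_on with
  | empty => exact ⟨0, rfl⟩
  | cons U z ih =>
    obtain ⟨x, rfl⟩ := ih fun V hV => hz V (Multiset.mem_cons_of_mem hV)
    have hU := hz U (Multiset.mem_cons_self U _)
    obtain ⟨y, rfl⟩ := exists_divisorOf_eq hdiv e hU.2.1
    exact ⟨⟨y, (irreducible_iff_isZeroSumAtom hdiv e y).2 hU⟩ ::ₘ x, Multiset.map_cons _ _ _⟩

/-- The common part `R` divides the gcd, so it is cancelled. -/
theorem factDist_add_le (Z₁ Z₂ R : Factorization H) :
    factDist (Z₁ + R) (Z₂ + R) ≤ max Z₁.card Z₂.card := by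
  classical
  rw [factDist]
  have hR : R ≤ (Z₁ + R) ∩ (Z₂ + R) :=
    Multiset.le_inter (Multiset.le_add_left _ _) (Multiset.le_add_left _ _)
  have h1 : Z₁ + R - (Z₁ + R) ∩ (Z₂ + R) ≤ Z₁ :=
    (tsub_le_tsub_left hR _).trans (add_tsub_cancel_right _ _).le
  have h2 : Z₂ + R - (Z₁ + R) ∩ (Z₂ + R) ≤ Z₂ :=
    (tsub_le_tsub_left hR _).trans (add_tsub_cancel_right _ _).le
  refine max_le_max (Multiset.card_le_card ?_) (Multiset.card_le_card ?_)
  · convert h1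
  · convert h2

theorem card_le_and_factDist_le_of_step (hdiv : IsDivisorHom φ) (e : ClassGrp φ ≃+ ℤ)
    {S : Multiset P} {B : ℕ} {z z' : Factorization H}
    (h : Step (primeWeight φ e) S B (divisorsOf φ z) (divisorsOf φ z')) :
    z.card ≤ z'.card ∧ factDist z z' ≤ B := by
  have hat : ∀ x : Factorization H, ∀ U ∈ divisorsOf φ x, IsZeroSumAtom (primeWeight φ e) U := by
    intro x U hU
    obtain ⟨y, -, rfl⟩ := Multiset.mem_map.1 hU
    exact (irreducible_iff_isZeroSumAtom hdiv e y.1).1 y.2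
  obtain ⟨-, Z₁, Z₂, R, h1, h2, h3, h4⟩ := h
  have hz := hat z
  have hz' := hat z'
  rw [h1] at hz
  rw [h2] at hz'
  obtain ⟨Z₁, rfl⟩ := exists_divisorsOf_eq hdiv e fun U hU => hz U (Multiset.mem_add.2 (.inl hU))
  obtain ⟨Z₂, rfl⟩ := exists_divisorsOf_eq hdiv e fun U hU => hz' U (Multiset.mem_add.2 (.inl hU))
  obtain ⟨R, rfl⟩ := exists_divisorsOf_eq hdiv e fun U hU => hz U (Multiset.mem_add.2 (.inr hU))
  have hz1 : z = Z₁ + R :=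
    divisorsOf_injective hdiv (h1.trans (Multiset.map_add _ _ _).symm)
  have hz2 : z' = Z₂ + R :=
    divisorsOf_injective hdiv (h2.trans (Multiset.map_add _ _ _).symm)
  rw [card_divisorsOf] at h4
  rw [card_divisorsOf, card_divisorsOf] at h3
  subst hz1 hz2
  refine ⟨by rw [Multiset.card_add, Multiset.card_add]; omega, ?_⟩
  exact (factDist_add_le Z₁ Z₂ R).trans (max_le (h3.trans h4) h4)

/-- Chains in the combinatorial model yield chains of factorizations. -/
theorem exists_chain (hdiv : IsDivisorHom φ) (e : ClassGrp φ ≃+ ℤ) (a : H) {B : ℕ}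
    {z' y' : Multiset (Multiset P)}
    (h : Relation.ReflTransGen (Step (primeWeight φ e) (Multiplicative.toAdd (φ a)) B) z' y') :
    ∀ z y : Factorization H, z ∈ factorizations a → divisorsOf φ z = z' → divisorsOf φ y = y' →
      ∃ (r : ℕ) (c : ℕ → Factorization H), c 0 = z ∧ c r = y ∧
        (∀ i ≤ r, c i ∈ factorizations a) ∧ (∀ i < r, (c i).card ≤ (c (i + 1)).card) ∧
        ∀ i < r, factDist (c i) (c (i + 1)) ≤ B := by
  induction h using Relation.ReflTransGen.head_induction_on with
  | refl =>
    intro z y hz h1 h2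
    obtain rfl : z = y := divisorsOf_injective hdiv (h1.trans h2.symm)
    exact ⟨0, fun _ => z, rfl, rfl, fun _ _ => hz, by simp, by simp⟩
  | head hstep _ ih =>
    intro z y hz h1 h2
    obtain ⟨x, rfl⟩ := exists_divisorsOf_eq hdiv e hstep.1.1
    subst h1
    have hx := (isFactorization_divisorsOf_iff hdiv e a x).1 hstep.1
    obtain ⟨r, c, hc0, hcr, hc1, hc2, hc3⟩ := ih x y hx rfl h2
    have hzx := card_le_and_factDist_le_of_step hdiv e hstep
    refine ⟨r + 1, fun i => Nat.casesOn i z c, rfl, hcr, ?_, ?_, ?_⟩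
    · rintro (_ | i) hi
      · exact hz
      · exact hc1 i (by omega)
    · rintro (_ | i) hi
      · change z.card ≤ (c 0).card
        rw [hc0]
        exact hzx.1
      · exact hc2 i (by omega)
    · rintro (_ | i) hi
      · change factDist z (c 0) ≤ B
        rw [hc0]
        exact hzx.2
      · exact hc3 i (by omega)

theorem terms_blockHom (e : ClassGrp φ ≃+ ℤ) (a : H) :
    terms (blockHom φ e a).1 = (Multiplicative.toAdd (φ a)).map (primeWeight φ e) :=
  terms_preBlockHom φ e (φ a)

theorem posLength_add_zeroMult_blockHom (e : ClassGrp φ ≃+ ℤ) (a : H) :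
    posLength (blockHom φ e a).1 + zeroMult (blockHom φ e a).1 =
      (nonnegTerms (primeWeight φ e) (Multiplicative.toAdd (φ a))).card := by
  rw [posLength, zeroMult, terms_blockHom, nonnegTerms]
  induction Multiplicative.toAdd (φ a) using Multiset.induction_on with
  | empty => rfl
  | cons p S ih =>
    rcases lt_trichotomy (primeWeight φ e p) 0 with h | h | h
    · simp only [Multiset.map_cons, Multiset.filter_cons, Multiset.count_cons, h.not_gt, h.not_ge,
        h.ne', if_false, zero_add, add_zero, ih]
    · simp only [Multiset.map_cons, Multiset.filter_cons, Multiset.count_cons, h, lt_irrefl,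
        le_refl, if_false, if_true, zero_add, Multiset.card_add, Multiset.card_singleton]
      omega
    · simp only [Multiset.map_cons, Multiset.filter_cons, Multiset.count_cons, h, h.le,
        h.ne, if_false, if_true, add_zero, Multiset.card_add, Multiset.card_singleton]
      omega

end Transfer

/-! ### Comparing minima of sets of classes. -/

section AbsMin

theorem neg_absMin_le {X : Set ℤ} (hX : BddBelow X) {g : ℤ} (hg : g ∈ X) :
    -(absMin X : ℤ) ≤ g := by
  have := csInf_le hX hg
  rw [absMin]
  omega

/-- A nonpositive element makes both infima nonpositive, so absolute values reverse their order. For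
empty `X` the value is 0. -/
theorem absMin_le_absMin {X Y : Set ℤ} (hXY : X ⊆ Y) (hY : BddBelow Y)
    (h : X.Nonempty → ∃ g ∈ X, g ≤ 0) : absMin X ≤ absMin Y := by
  rcases X.eq_empty_or_nonempty with rfl | hne
  · simp [absMin]
  · obtain ⟨g, hg, hg0⟩ := h hne
    have h1 := csInf_le (hY.mono hXY) hg
    have h2 := csInf_le_csInf hY hne hXY
    rw [absMin, absMin]
    omega

theorem bddBelow_of_finite_negPart {X : Set ℤ} (hX : (negPart X).Finite) : BddBelow X := by
  obtain ⟨m, hm⟩ := hX.bddBelow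
  refine ⟨min m 0, fun g hg => ?_⟩
  by_cases h : g < 0
  · exact (min_le_left _ _).trans (hm ⟨hg, h⟩)
  · exact (min_le_right _ _).trans (not_lt.1 h)

theorem exists_nonpos_mem_supp {G₀ : Set ℤ} {T : FreeAb G₀} (hT : seqSum T = 0)
    (hne : (supp T).Nonempty) : ∃ g ∈ supp T, g ≤ 0 := by
  by_contra! hcon
  obtain ⟨g, hg⟩ := hne
  have h0 : terms T ≠ 0 := fun h => by
    have hg' : g ∈ terms T := hg
    simp [h] at hg'
  have := Multiset.sum_lt_sum_of_nonempty (s := terms T) (f := fun _ => 0) (g := id) h0 hcon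
  rw [Multiset.map_id] at this
  simp only [Multiset.map_const', Multiset.sum_replicate, smul_zero] at this
  exact this.ne hT.symm

theorem supp_subset {G₀ : Set ℤ} (T : FreeAb G₀) : supp T ⊆ G₀ := by
  intro g hg
  have hg' : g ∈ terms T := hg
  rw [terms_eq_map] at hg'
  obtain ⟨x, -, rfl⟩ := Multiset.mem_map.1 hg'
  exact x.2

end AbsMin

end KrullFact

theorem mainTheorem4 {H : Type u} [CancelCommMonoid H] (hH : IsKrullMonoid H)
    {P : Type v} (φ : H →* FreeAb P) (hdiv : IsDivisorHom φ) (hcof : IsCofinalHom φ)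
    (e : ClassGrp φ ≃+ ℤ) (hfin : (negPart (primeClasses φ e)).Finite) (a : H)
    (ha : IsGreatest (lengths a)
      (posLength (blockHom φ e a).1 + zeroMult (blockHom φ e a).1)) :
    (∀ z ∈ factorizations a, ∀ y ∈ factorizations a, IsGreatest (lengths a) y.card →
      ∃ (r : ℕ) (c : ℕ → Factorization H),
        c 0 = z ∧ c r = y ∧
        (∀ i ≤ r, c i ∈ factorizations a) ∧
        (∀ i < r, (c i).card ≤ (c (i + 1)).card) ∧
        (∀ i < r, (factDist (c i) (c (i + 1)) : ℕ∞) ≤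
          stepBound (absMin (supp (blockHom φ e a).1)) (primeClasses φ e))) ∧
    stepBound (absMin (supp (blockHom φ e a).1)) (primeClasses φ e) ≤
      stepBound (absMin (primeClasses φ e)) (primeClasses φ e) ∧
    stepBound (absMin (primeClasses φ e)) (primeClasses φ e) < ⊤ ∧
    relDavenport (symmetricPairs (negPart (primeClasses φ e))) < ⊤ := by
  have : Finite (negPart (primeClasses φ e)) := hfin.to_subtype
  have hD : relDavenport (symmetricPairs (negPart (primeClasses φ e))) < ⊤ :=
    relDavenport_lt_top _
  have hbdd := bddBelow_of_finite_negPart hfin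
  obtain ⟨N, hN⟩ := ENat.ne_top_iff_exists.1 hD.ne
  have hbound : ∀ M : ℕ, stepBound M (primeClasses φ e) = ((max (M * N) 2 : ℕ) : ℕ∞) := by
    intro M
    rw [stepBound, ← hN]
    rfl
  refine ⟨?_, ?_, ?_, hD⟩
  · intro z hz y hy hymax
    have hcard : y.card = (nonnegTerms (primeWeight φ e) (Multiplicative.toAdd (φ a))).card := by
      rw [← posLength_add_zeroMult_blockHom]
      exact hymax.unique ha
    have hM : ∀ p ∈ Multiplicative.toAdd (φ a),
        -(absMin (supp (blockHom φ e a).1) : ℤ) ≤ primeWeight φ e p := by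
      intro p hp
      refine neg_absMin_le (hbdd.mono (supp_subset _)) ?_
      change _ ∈ terms _
      rw [terms_blockHom]
      exact Multiset.mem_map_of_mem _ hp
    have hchain := reflTransGen_step
      ((isFactorization_divisorsOf_iff hdiv e a z).2 hz)
      ((isFactorization_divisorsOf_iff hdiv e a y).2 hy)
      (by rw [card_divisorsOf, hcard]) (G₀ := negPart (primeClasses φ e)) (fun g hg => hg.2)
      -- The step bound is `max (M * N) 2`: `M * N` serves the exchanges, 2 the swaps.
      (fun p hp => ⟨⟨p, rfl⟩, hp⟩) hN.symm hM (le_max_left _ 2) (le_max_right _ 2)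
    obtain ⟨r, c, h0, hr, h1, h2, h3⟩ := exists_chain hdiv e a hchain z y hz rfl rfl
    refine ⟨r, c, h0, hr, h1, h2, fun i hi => ?_⟩
    rw [hbound]
    exact_mod_cast h3 i hi
  · rw [hbound, hbound]
    have hle : absMin (supp (blockHom φ e a).1) ≤ absMin (primeClasses φ e) :=
      absMin_le_absMin (supp_subset _) hbdd (exists_nonpos_mem_supp (blockHom φ e a).2)
    exact_mod_cast max_le_max (Nat.mul_le_mul_right N hle) le_rfl
  · rw [hbound]
    exact ENat.natCast_lt_top _
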